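/- For $a,b,c\in\mathbb R^2$ let the orientation of $(a,b,c)$ be the sign of $(b_1-a_1)(c_2-a_2)-(b_2-a_2)(c_1-a_1)$ (counterclockwise, collinear or clockwise). Two finite point sets have the same order type if some bijection between them preserves the orientations of all ordered triples. A finite set $S\subset\mathbb R^2$ avoids a finite set $X\subset\mathbb R^2$ if no subset of $S$ has the same order type as $X$. An algorithm is a program for a unit-cost random access machine (registers holding natural numbers; addition, truncated subtraction, indirect addressing, tests and loops, no multiplication). It receives a set $P$ of $n$ points of the plane through the number $n$ and an instruction that returns, in one step, the orientation of the three points with given indices in $\{0,\dots,n-1\}$; the points are numbered in an arbitrary order. It also receives a natural number $k$, and outputs lists of indices of points. **Theorem.** Let $X\subset\mathbb R^2$ be any fixed finite set of points. 1. Finding a $k$-point subset avoiding $X$ among a given set of points in the plane is fixed-parameter tractable with parameter $k$: there are an algorithm, a computable function $f:\mathbb N\to\mathbb N$ and a constant $c$ (all depending only on $X$) such that, for every set $P$ of $n$ points of the plane and every $k$, the algorithm halts within $f(k)\,(n+1)^c$ steps, and outputs a $k$-point subset of $P$ that avoids $X$ if there is one, and reports that there is none otherwise. 2. If $X$ is collinear,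 then the problem has a kernel with $O(k^4)$ points: there are a constant $C$ and an algorithm (depending only on $X$) which, for every set $P$ of $n$ points of the plane and every $k$, computes in time polynomial in $n$ a subset $P'\subseteq P$ with $|P'|\le C\,k^4$ such that $P'$ has a $k$-point subset avoiding $X$ if and only if $P$ has one. -/

import Mathlib

namespace PointPatterns

/-! ### Order types of planar point sets -/

/-- The Euclidean plane. -/
abbrev Plane : Type := EuclideanSpace ℝ (Fin 2)

/-- The orientation of an ordered triple of points: `1` if the triple is counterclockwise,
`-1` if it is clockwise, `0` if the three points are collinear. -/
noncomputable def orientation (a b c : Plane) : SignType :=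
  SignType.sign ((b 0 - a 0) * (c 1 - a 1) - (b 1 - a 1) * (c 0 - a 0))

/-- Two finite point sets have the same order type: some bijection between them preserves the
orientation of every ordered triple. -/
def SameOrderType (X Y : Finset Plane) : Prop :=
  ∃ e : X ≃ Y, ∀ a b c : X,
    orientation (e a : Plane) (e b : Plane) (e c : Plane) = orientation (a : Plane) b c

/-- `S` contains no copy of the pattern `X`: no subset of `S` has the order type of `X`. -/
def Avoids (X S : Finset Plane) : Prop :=
  ¬ ∃ Y : Finset Plane, Y ⊆ S ∧ SameOrderType X Y

/-- Some `k`-point subset of `P` has the property `prop`. -/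
def HasSubset (prop : Finset Plane → Prop) (P : Finset Plane) (k : ℕ) : Prop :=
  ∃ S : Finset Plane, S ⊆ P ∧ S.card = k ∧ prop S

/-! ### Random access machines with orientation queries -/

/-- The memory of a random access machine: registers numbered by `ℕ`, each holding a natural
number. -/
abbrev Memory : Type := ℕ → ℕ

/-- Programs of a random access machine with addition, truncated subtraction, indirect
addressing, structured control flow, and an instruction that queries the orientation of three
input points.  There is no multiplication, so that unit costs are polynomially related to Turing
machine time. -/
inductive Program : Type
  /-- Do nothing. -/
  | skip : Program
  /-- `R[i] := v`, for a constant `v`. -/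
  | const (i v : ℕ) : Program
  /-- `R[i] := R[j]`. -/
  | copy (i j : ℕ) : Program
  /-- `R[i] := R[j] + R[l]`. -/
  | add (i j l : ℕ) : Program
  /-- `R[i] := R[j] - R[l]`, truncated at `0`. -/
  | sub (i j l : ℕ) : Program
  /-- `R[i] := R[R[j]]`. -/
  | load (i j : ℕ) : Program
  /-- `R[R[i]] := R[j]`. -/
  | store (i j : ℕ) : Program
  /-- `R[i] :=` the orientation of the input points with indices `R[a]`, `R[b]`, `R[c]`. -/
  | query (i a b c : ℕ) : Program
  /-- First the one program, then the other. -/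
  | seq (p q : Program) : Program
  /-- If `R[i] ≠ 0` then the first program, else the second. -/
  | branch (i : ℕ) (p q : Program) : Program
  /-- While `R[i] ≠ 0`, repeat the program. -/
  | loop (i : ℕ) (p : Program) : Program

/-- `Exec χ p R t R'`: with `χ` answering the orientation queries, the program `p` started on
memory `R` halts after exactly `t` steps with memory `R'`.  Every instruction, and every test of a
`branch` or a `loop`, is one step. -/
inductive Exec (χ : ℕ → ℕ → ℕ → ℕ) : Program → Memory → ℕ → Memory → Prop
  | skip (R : Memory) : Exec χ .skip R 1 R
  | const (R : Memory) (i v : ℕ) : Exec χ (.const i v) R 1 (Function.update R i v)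
  | copy (R : Memory) (i j : ℕ) : Exec χ (.copy i j) R 1 (Function.update R i (R j))
  | add (R : Memory) (i j l : ℕ) : Exec χ (.add i j l) R 1 (Function.update R i (R j + R l))
  | sub (R : Memory) (i j l : ℕ) : Exec χ (.sub i j l) R 1 (Function.update R i (R j - R l))
  | load (R : Memory) (i j : ℕ) : Exec χ (.load i j) R 1 (Function.update R i (R (R j)))
  | store (R : Memory) (i j : ℕ) : Exec χ (.store i j) R 1 (Function.update R (R i) (R j))
  | query (R : Memory) (i a b c : ℕ) :
      Exec χ (.query i a b c) R 1 (Function.update R i (χ (R a) (R b) (R c)))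
  | seq {p q : Program} {R R' R'' : Memory} {t t' : ℕ} :
      Exec χ p R t R' → Exec χ q R' t' R'' → Exec χ (.seq p q) R (t + t') R''
  | branch_pos {i : ℕ} {p q : Program} {R R' : Memory} {t : ℕ} :
      R i ≠ 0 → Exec χ p R t R' → Exec χ (.branch i p q) R (t + 1) R'
  | branch_zero {i : ℕ} {p q : Program} {R R' : Memory} {t : ℕ} :
      R i = 0 → Exec χ q R t R' → Exec χ (.branch i p q) R (t + 1) R'
  | loop_zero {i : ℕ} {p : Program} {R : Memory} :
      R i = 0 → Exec χ (.loop i p) R 1 R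
  | loop_pos {i : ℕ} {p : Program} {R R' R'' : Memory} {t t' : ℕ} :
      R i ≠ 0 → Exec χ p R t R' → Exec χ (.loop i p) R' t' R'' →
        Exec χ (.loop i p) R (t + 1 + t') R''

/-- Orientations as natural numbers: `0` collinear, `1` counterclockwise, `2` clockwise. -/
def orientationCode : SignType → ℕ
  | .zero => 0
  | .pos => 1
  | .neg => 2

/-- The answers to orientation queries about the points `pts 0, …, pts (n - 1)`; a query that
involves an index outside this range is answered by `0`. -/
noncomputable def orientationOracle {n : ℕ} (pts : Fin n ↪ Plane) (a b c : ℕ) : ℕ :=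
  if h : a < n ∧ b < n ∧ c < n then
    orientationCode (orientation (pts ⟨a, h.1⟩) (pts ⟨b, h.2.1⟩) (pts ⟨c, h.2.2⟩))
  else 0

/-- The initial memory: the number `n` of points in register `0`, the parameter `k` in
register `1`, and `0` elsewhere. -/
def initialMemory (n k : ℕ) : Memory := fun i => if i = 0 then n else if i = 1 then k else 0

/-- The memory `R` lists, without repetition, exactly the indices in `I`: register `0` holds the
length of the list and register `1` the address of its first entry. -/
def ListsIndices {n : ℕ} (R : Memory) (I : Finset (Fin n)) : Prop :=
  (((List.range (R 0)).map fun j => R (R 1 + j) : List ℕ) : Multiset ℕ) = I.val.map Fin.val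

/-! ### Fixed-parameter tractability and kernels -/

/-- Finding a `k`-point subset with property `prop` in a given set of `n` points of the plane is
fixed-parameter tractable with parameter `k`: one program, on every input, halts within
`f k * (n + 1) ^ c` steps, for a computable function `f` and a constant `c`, and either lists such
a subset (with `1` in register `2`) or reports correctly that there is none (with `0` in
register `2`). -/
def SubsetFPT (prop : Finset Plane → Prop) : Prop :=
  ∃ (p : Program) (f : ℕ → ℕ) (c : ℕ), Computable f ∧
    ∀ (n : ℕ) (pts : Fin n ↪ Plane) (k : ℕ), ∃ (t : ℕ) (R : Memory),
      Exec (orientationOracle pts) p (initialMemory n k) t R ∧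
      t ≤ f k * (n + 1) ^ c ∧
      ((R 2 = 1 ∧ ∃ I : Finset (Fin n), ListsIndices R I ∧ I.card = k ∧ prop (I.map pts)) ∨
        (R 2 = 0 ∧ ¬ HasSubset prop (Finset.univ.map pts) k))

/-- Finding a `k`-point subset with property `prop` has a kernel of at most `size k` points: one
program, on every set of `n` points and every `k`, halts within a polynomial number of steps in
`n` and lists a subset of at most `size k` of the given points that contains a solution if and
only if the given set does. -/
def SubsetKernel (prop : Finset Plane → Prop) (size : ℕ → ℕ) : Prop :=
  ∃ (p : Program) (d c : ℕ),
    ∀ (n : ℕ) (pts : Fin n ↪ Plane) (k : ℕ), ∃ (t : ℕ) (R : Memory),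
      Exec (orientationOracle pts) p (initialMemory n k) t R ∧
      t ≤ d * (n + 1) ^ c ∧
      ∃ I : Finset (Fin n), ListsIndices R I ∧ I.card ≤ size k ∧
        (HasSubset prop (I.map pts) k ↔ HasSubset prop (Finset.univ.map pts) k)

end PointPatterns

/-! The algorithm is brute force over few candidates. A predicate of points, depending on a tuple
`q` of `r` indices with `r` fixed by `X`, selects candidates, and only the first `N = 2 ^ (D * (k *
k + k + 1))` of them are kept. A subset of these is a bit mask `v < 2 ^ N`. Trying all `q` and `v`
costs a function of `k` times a fixed power of `n + 1`, so it remains to choose the predicate so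
that a solvable instance keeps a solution among the first `N` candidates for some `q`. Either fewer
than `N` candidates exist, and then all are kept, or `N` of them are present and force a solution by
a Ramsey-type argument.

The common geometric tool is `exists_genPos_span`: a maximal subset `Q` in general position spans
lines covering the whole set. So a large set has many points on a line or a large `Q`, and by
Erdős–Szekeres (`exists_convexPos`) a large `Q` contains many points in convex position.

If `X` is collinear, avoiding `X` means having no `X.card` points on a line. A point of a solution
can be exchanged for an earlier point when `k ^ 2` earlier points lie on a line through it and
another given point (`NoCol.exchange`). A solution with least sum of indices therefore uses only
points that are not crowded in this way. No line contains more than `k ^ 2` uncrowded points, so `k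
^ 4` of them span a general-position set of `k` points. This also yields the kernel.

If `X` is neither collinear nor in convex position, every collinear set and every set in convex
position avoids `X`, and one of size `k` exists among any `N` points.

If `X` is in convex position but not collinear, a solution has a spanning set `Q` in general
position without `X.card` points in convex position, hence of size at most a constant `r`. The tuple
`q` guesses `Q`, and the candidates are the points it spans. If there are `N` of them, one pair
spans `k` collinear points, which avoid `X`.

The programs are obtained by compiling expressions. Each expression has an exponent `a` such that
its value and its running time are at most `B ^ a` whenever `B` is at least `2` and bounds the
registers it uses (`Expr.exists_spec`). -/

namespace PointPatterns

/-! ### Running programs -/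

/-- `p` started on `R` halts within `T` steps in a memory satisfying `Q`. -/
def Run (χ : ℕ → ℕ → ℕ → ℕ) (p : Program) (R : Memory) (T : ℕ) (Q : Memory → Prop) : Prop :=
  ∃ t R', Exec χ p R t R' ∧ t ≤ T ∧ Q R'

namespace Run

variable {χ : ℕ → ℕ → ℕ → ℕ} {p q : Program} {R : Memory} {T T' : ℕ} {Q Q' : Memory → Prop}

theorem mono (h : Run χ p R T Q) (hT : T ≤ T') (hQ : ∀ R', Q R' → Q' R') : Run χ p R T' Q' := by
  obtain ⟨t, R', h1, h2, h3⟩ := h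
  exact ⟨t, R', h1, h2.trans hT, hQ _ h3⟩

theorem seq (h : Run χ p R T (fun R' => Run χ q R' T' Q)) : Run χ (.seq p q) R (T + T') Q := by
  obtain ⟨t, R', h1, h2, t', R'', h3, h4, h5⟩ := h
  exact ⟨t + t', R'', .seq h1 h3, by omega, h5⟩

theorem const {i v : ℕ} (h : Q (Function.update R i v)) : Run χ (.const i v) R 1 Q :=
  ⟨1, _, .const R i v, le_rfl, h⟩

theorem copy {i j : ℕ} (h : Q (Function.update R i (R j))) : Run χ (.copy i j) R 1 Q :=
  ⟨1, _, .copy R i j, le_rfl, h⟩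

theorem add {i j l : ℕ} (h : Q (Function.update R i (R j + R l))) : Run χ (.add i j l) R 1 Q :=
  ⟨1, _, .add R i j l, le_rfl, h⟩

theorem sub {i j l : ℕ} (h : Q (Function.update R i (R j - R l))) : Run χ (.sub i j l) R 1 Q :=
  ⟨1, _, .sub R i j l, le_rfl, h⟩

theorem store {i j : ℕ} (h : Q (Function.update R (R i) (R j))) : Run χ (.store i j) R 1 Q :=
  ⟨1, _, .store R i j, le_rfl, h⟩

theorem query {i a b c : ℕ} (h : Q (Function.update R i (χ (R a) (R b) (R c)))) :
    Run χ (.query i a b c) R 1 Q :=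
  ⟨1, _, .query R i a b c, le_rfl, h⟩

/-- A loop counting the register `i` down to `0` with loop invariant `Inv`. -/
theorem loop {i : ℕ} {Inv : ℕ → Memory → Prop}
    (h : ∀ j R, R i = j + 1 → Inv (j + 1) R → Run χ p R T (fun R' => R' i = j ∧ Inv j R')) :
    ∀ j R, R i = j → Inv j R → Run χ (.loop i p) R (j * (T + 1) + 1) (Inv 0) := by
  intro j
  induction j with
  | zero => exact fun R h0 hI => ⟨1, R, .loop_zero h0, by omega, hI⟩
  | succ j ih =>
    intro R hj hI
    obtain ⟨t, R', h1, h2, h3, h4⟩ := h j R hj hI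
    obtain ⟨t', R'', h5, h6, h7⟩ := ih R' h3 h4
    refine ⟨t + 1 + t', R'', .loop_pos (by omega) h1 h5, ?_, h7⟩
    rw [Nat.succ_mul]
    omega

end Run

/-! ### Expressions -/

/-- Arithmetic expressions with orientation queries. The variables are the registers. -/
inductive Expr : Type
  | var (x : ℕ) : Expr
  | const (c : ℕ) : Expr
  | add (a b : Expr) : Expr
  | sub (a b : Expr) : Expr
  | query (a b c : Expr) : Expr
  /-- The sum of the values of `e` for `x` below `c`. -/
  | sum (x : ℕ) (c e : Expr) : Expr
  /-- Starting from `a`, subtract `c` times the value of `e` at the current value `y`. -/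
  | desc (y : ℕ) (c a e : Expr) : Expr

namespace Expr

variable (χ : ℕ → ℕ → ℕ → ℕ)

/-- The value of an expression. -/
def eval : Expr → Memory → ℕ
  | var x, R => R x
  | const c, _ => c
  | add a b, R => eval a R + eval b R
  | sub a b, R => eval a R - eval b R
  | query a b c, R => χ (eval a R) (eval b R) (eval c R)
  | sum x c e, R => ∑ i ∈ Finset.range (eval c R), eval e (Function.update R x i)
  | desc y c a e, R =>
      (fun acc => acc - eval e (Function.update R y acc))^[eval c R] (eval a R)

/-- All variables of the expression, bound ones included, are below `V`. -/
def Below (V : ℕ) : Expr → Prop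
  | var x => x < V
  | const _ => True
  | add a b => Below V a ∧ Below V b
  | sub a b => Below V a ∧ Below V b
  | query a b c => Below V a ∧ Below V b ∧ Below V c
  | sum x c e => x < V ∧ Below V c ∧ Below V e
  | desc y c a e => y < V ∧ Below V c ∧ Below V a ∧ Below V e

/-- The number of scratch registers used by the compiled expression. -/
def width : Expr → ℕ
  | var _ => 1
  | const _ => 1
  | add a b => a.width + b.width + 1
  | sub a b => a.width + b.width + 1
  | query a b c => a.width + b.width + c.width + 2
  | sum _ c e => c.width + e.width + 4
  | desc _ c a e => c.width + a.width + e.width + 4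

/-- A program computing the expression into register `d`. -/
def compile : Expr → ℕ → Program
  | var x, d => .copy d x
  | const c, d => .const d c
  | add a b, d => .seq (compile a d) (.seq (compile b (d + 1)) (.add d d (d + 1)))
  | sub a b, d => .seq (compile a d) (.seq (compile b (d + 1)) (.sub d d (d + 1)))
  | query a b c, d => .seq (compile a d) (.seq (compile b (d + 1))
      (.seq (compile c (d + 2)) (.query d d (d + 1) (d + 2))))
  -- Register `d` accumulates, `d + 1` counts down, `d + 2` saves the bound variable for
  -- restoration, and scratch space for the body starts at `d + 3`. The same layout serves `desc`.
  | sum x c e, d =>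
      .seq (compile c (d + 1)) (.seq (.const d 0) (.seq (.copy (d + 2) x) (.seq
        (.loop (d + 1) (.seq (.const (d + 3) 1) (.seq (.sub (d + 1) (d + 1) (d + 3))
          (.seq (.copy x (d + 1)) (.seq (compile e (d + 3)) (.add d d (d + 3)))))))
        (.copy x (d + 2)))))
  | desc y c a e, d =>
      .seq (compile a d) (.seq (compile c (d + 1)) (.seq (.copy (d + 2) y) (.seq
        (.loop (d + 1) (.seq (.const (d + 3) 1) (.seq (.sub (d + 1) (d + 1) (d + 3))
          (.seq (.copy y d) (.seq (compile e (d + 3)) (.sub d d (d + 3)))))))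
        (.copy y (d + 2)))))

variable {χ}

/-- This separates variables from scratch space: code using registers from `V` on cannot disturb the
value of an expression below `V`. -/
theorem eval_congr {V : ℕ} (e : Expr) (he : Below V e) {R R' : Memory}
    (h : ∀ j < V, R j = R' j) : eval χ e R = eval χ e R' := by
  have upd : ∀ {R R' : Memory} (x i : ℕ), (∀ j < V, R j = R' j) →
      ∀ j < V, Function.update R x i j = Function.update R' x i j := by
    intro R R' x i h j hj
    by_cases hjx : j = x
    · subst hjx; simp
    · simp [hjx, h j hj]
  induction e generalizing R R' with
  | var x => exact h x he
  | const c => rfl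
  | add a b iha ihb => simp only [eval, iha he.1 h, ihb he.2 h]
  | sub a b iha ihb => simp only [eval, iha he.1 h, ihb he.2 h]
  | query a b c iha ihb ihc => simp only [eval, iha he.1 h, ihb he.2.1 h, ihc he.2.2 h]
  | sum x c e ihc ihe =>
    simp only [eval, ihc he.2.1 h]
    exact Finset.sum_congr rfl fun i _ => ihe he.2.2 (upd x i h)
  | desc y c a e ihc iha ihe =>
    simp only [eval, ihc he.2.1 h, iha he.2.2.1 h]
    congr 1
    funext acc
    rw [ihe he.2.2.2 (upd y acc h)]

theorem width_pos (e : Expr) : 0 < e.width := by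
  cases e <;> simp only [width] <;> omega

theorem iterate_desc_le (f : ℕ → ℕ) (n a : ℕ) : (fun acc => acc - f acc)^[n] a ≤ a := by
  induction n with
  | zero => exact le_rfl
  | succ n ih => rw [Function.iterate_succ_apply']; exact (Nat.sub_le _ _).trans ih

theorem one_le_pow_of_two_le {B : ℕ} (hB : 2 ≤ B) (a : ℕ) : 1 ≤ B ^ a :=
  Nat.one_le_pow _ _ (by omega)

/-- The specification of `compile`. -/
def Spec (V : ℕ) (e : Expr) (a : ℕ) : Prop :=
  1 ≤ a ∧ ∀ (χ : ℕ → ℕ → ℕ → ℕ), (∀ i j l, χ i j l ≤ 2) → ∀ d, V ≤ d → ∀ (R : Memory) (B : ℕ),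
    2 ≤ B → (∀ j < V, R j ≤ B) → eval χ e R ≤ B ^ a ∧
      Run χ (compile e d) R (B ^ a) fun R' => R' d = eval χ e R ∧
        ∀ j, (j < d ∨ d + e.width ≤ j) → R' j = R j

theorem spec_binary {V a b : ℕ} {e₁ e₂ e : Expr} (h₂ : Below V e₂)
    (H₁ : Spec V e₁ a) (H₂ : Spec V e₂ b)
    (he : e = .add e₁ e₂ ∨ e = .sub e₁ e₂) : Spec V e (a + b + 2) := by
  refine ⟨by omega, fun χ hχ d hd R B hB hR => ?_⟩
  obtain ⟨v1, r1⟩ := H₁.2 χ hχ d hd R B hB hR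
  have hb : B ^ a + (B ^ b + 1) ≤ B ^ (a + b + 2) := by
    have h1 := one_le_pow_of_two_le hB a
    have h2 := one_le_pow_of_two_le hB b
    have h3 : 4 ≤ B ^ 2 := by nlinarith
    rw [pow_add, pow_add]
    have h4 : B ^ a * B ^ b * 4 ≤ B ^ a * B ^ b * B ^ 2 := Nat.mul_le_mul_left _ h3
    nlinarith
  have v2 := (H₂.2 χ hχ (d + 1) (by omega) R B hB hR).1
  have key : ∀ R', (R' d = eval χ e₁ R ∧ ∀ j, (j < d ∨ d + e₁.width ≤ j) → R' j = R j) →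
      Run χ (compile e₂ (d + 1)) R' (B ^ b) (fun R'' => R'' d = eval χ e₁ R ∧
        R'' (d + 1) = eval χ e₂ R ∧
        ∀ j, (j < d ∨ d + (e₁.width + e₂.width + 1) ≤ j) → R'' j = R j) := by
    intro R' ⟨hd', hj'⟩
    have hR' : ∀ j < V, R' j = R j := fun j hj => hj' j (by omega)
    refine (H₂.2 χ hχ (d + 1) (by omega) R' B hB fun j hj => by rw [hR' j hj]; exact hR j hj).2.mono
      le_rfl ?_
    intro R'' ⟨hd'', hj''⟩
    refine ⟨by rw [hj'' d (by omega), hd'], by rw [hd'', eval_congr e₂ h₂ hR'], fun j hj => ?_⟩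
    rw [hj'' j (by omega), hj' j (by omega)]
  have fin : ∀ (R'' : Memory) (v : ℕ), (∀ j, (j < d ∨ d + (e₁.width + e₂.width + 1) ≤ j) →
      R'' j = R j) → ∀ j, (j < d ∨ d + (e₁.width + e₂.width + 1) ≤ j) →
      Function.update R'' d v j = R j := by
    intro R'' v h j hj
    rw [Function.update_of_ne (by omega), h j hj]
  rcases he with rfl | rfl
  · refine ⟨by simp only [eval]; omega, ?_⟩
    refine Run.mono (Run.seq (r1.mono le_rfl fun R' h' => Run.seq ((key R' h').mono le_rfl
      fun R'' h'' => Run.add (Q := fun R' => R' d = eval χ (e₁.add e₂) R ∧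
        ∀ j, (j < d ∨ d + (e₁.add e₂).width ≤ j) → R' j = R j) ?_))) hb fun _ h => h
    exact ⟨by simp [eval, h''.1, h''.2.1], fin R'' _ h''.2.2⟩
  · refine ⟨by simp only [eval]; omega, ?_⟩
    refine Run.mono (Run.seq (r1.mono le_rfl fun R' h' => Run.seq ((key R' h').mono le_rfl
      fun R'' h'' => Run.sub (Q := fun R' => R' d = eval χ (e₁.sub e₂) R ∧
        ∀ j, (j < d ∨ d + (e₁.sub e₂).width ≤ j) → R' j = R j) ?_))) hb fun _ h => h
    exact ⟨by simp [eval, h''.1, h''.2.1], fin R'' _ h''.2.2⟩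

theorem spec_query {V a b c : ℕ} {e₁ e₂ e₃ : Expr} (h₂ : Below V e₂) (h₃ : Below V e₃)
    (H₁ : Spec V e₁ a) (H₂ : Spec V e₂ b) (H₃ : Spec V e₃ c) :
    Spec V (.query e₁ e₂ e₃) (a + b + c + 2) := by
  refine ⟨by omega, fun χ hχ d hd R B hB hR => ⟨?_, ?_⟩⟩
  · simp only [eval]
    calc _ ≤ 2 := hχ _ _ _
      _ ≤ B ^ 1 := by simpa using hB
      _ ≤ _ := Nat.pow_le_pow_right (by omega) (by omega)
  have hb : B ^ a + (B ^ b + (B ^ c + 1)) ≤ B ^ (a + b + c + 2) := by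
    have h1 := one_le_pow_of_two_le hB a
    have h2 := one_le_pow_of_two_le hB b
    have h2 := one_le_pow_of_two_le hB c
    have h3 : 4 ≤ B ^ 2 := by nlinarith
    have p1 : B ^ a ≤ B ^ (a + b + c) := Nat.pow_le_pow_right (by omega) (by omega)
    have p2 : B ^ b ≤ B ^ (a + b + c) := Nat.pow_le_pow_right (by omega) (by omega)
    have p3 : B ^ c ≤ B ^ (a + b + c) := Nat.pow_le_pow_right (by omega) (by omega)
    rw [pow_add B _ 2]
    nlinarith
  refine Run.mono (Run.seq ((H₁.2 χ hχ d hd R B hB hR).2.mono le_rfl fun R₁ g₁ => ?_)) hb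
    fun _ h => h
  have k₁ : ∀ j < V, R₁ j = R j := fun j hj => g₁.2 j (by omega)
  refine Run.seq ((H₂.2 χ hχ (d + 1) (by omega) R₁ B hB
    fun j hj => by rw [k₁ j hj]; exact hR j hj).2.mono le_rfl fun R₂ g₂ => ?_)
  have k₂ : ∀ j < V, R₂ j = R j := fun j hj => by rw [g₂.2 j (by omega), k₁ j hj]
  refine Run.seq ((H₃.2 χ hχ (d + 2) (by omega) R₂ B hB
    fun j hj => by rw [k₂ j hj]; exact hR j hj).2.mono le_rfl fun R₃ g₃ => Run.query ⟨?_, ?_⟩)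
  · simp only [Function.update_self, eval]
    rw [g₃.1, g₃.2 d (by omega), g₃.2 (d + 1) (by omega), g₂.1, g₂.2 d (by omega), g₁.1,
      eval_congr e₂ h₂ k₁, eval_congr e₃ h₃ k₂]
  · intro j hj
    simp only [width] at hj
    rw [Function.update_of_ne (by omega), g₃.2 j (by omega), g₂.2 j (by omega), g₁.2 j (by omega)]

/-- The bound variable stays below the number of terms, at most `B ^ a`. The body is therefore
analysed with `B ^ a` in place of `B`, which multiplies the exponents. -/
theorem spec_sum {V a b x : ℕ} {c e : Expr} (hx : x < V) (he : Below V e)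
    (Hc : Spec V c a) (He : Spec V e b) : Spec V (.sum x c e) (a + a * b + a + 4) := by
  refine ⟨by omega, fun χ hχ d hd R B hB hR => ?_⟩
  obtain ⟨vc, rc⟩ := Hc.2 χ hχ (d + 1) (by omega) R B hB hR
  have hB' : B ≤ B ^ a := Nat.le_self_pow (by have := Hc.1; omega) B
  have hup : ∀ i ≤ B ^ a, ∀ j < V, Function.update R x i j ≤ B ^ a := by
    intro i hi j hj
    by_cases h : j = x
    · subst h; simpa using hi
    · rw [Function.update_of_ne h]; exact (hR j hj).trans hB'
  set n := eval χ c R with hn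
  have hpos1 := one_le_pow_of_two_le hB a
  have hpos2 := one_le_pow_of_two_le hB (a * b)
  have hev : ∀ i ≤ B ^ a, eval χ e (Function.update R x i) ≤ B ^ (a * b) := fun i hi => by
    rw [pow_mul]
    exact (He.2 χ hχ d hd _ (B ^ a) (hB.trans hB') (hup i hi)).1
  have hmain : n * B ^ (a * b) ≤ B ^ a * B ^ (a * b) := Nat.mul_le_mul_right _ vc
  constructor
  · simp only [eval]
    calc _ ≤ ∑ i ∈ Finset.range n, B ^ (a * b) := Finset.sum_le_sum fun i hi =>
          hev i ((Finset.mem_range.1 hi).le.trans vc)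
      _ = n * B ^ (a * b) := by simp
      _ ≤ B ^ (a + a * b) := by rw [pow_add]; exact hmain
      _ ≤ _ := Nat.pow_le_pow_right (by omega) (by omega)
  have hb : B ^ a + (1 + (1 + (n * ((1 + (1 + (1 + (B ^ (a * b) + 1)))) + 1) + 1 + 1))) ≤
      B ^ (a + a * b + a + 4) := by
    have h3 : 16 ≤ B ^ 4 := by
      calc 16 = 2 ^ 4 := by norm_num
        _ ≤ _ := Nat.pow_le_pow_left hB 4
    have h4 : B ^ a * B ^ (a * b) * B ^ a * 16 ≤ B ^ a * B ^ (a * b) * B ^ a * B ^ 4 :=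
      Nat.mul_le_mul_left _ h3
    rw [pow_add, pow_add, pow_add]
    have h5 : B ^ a ≤ B ^ a * B ^ (a * b) * B ^ a := by nlinarith [Nat.mul_pos hpos1 hpos2]
    have h6 : B ^ a * B ^ (a * b) ≤ B ^ a * B ^ (a * b) * B ^ a :=
      Nat.le_mul_of_pos_right _ hpos1
    nlinarith
  refine Run.mono (Run.seq (rc.mono le_rfl fun R₁ g₁ => Run.seq (Run.const (Run.seq (Run.copy
    (Run.seq (Run.mono (Run.loop (Inv := fun j R' =>
      -- The counter runs downwards, so register `d` already holds the terms with index at least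
      -- `j`; those below `j` are still missing.
      j ≤ n ∧ R' d + ∑ i ∈ Finset.range j, eval χ e (Function.update R x i) = eval χ (.sum x c e) R ∧
      R' (d + 2) = R x ∧ ∀ j, (j < d ∨ d + (Expr.sum x c e).width ≤ j) → j ≠ x → R' j = R j)
      ?_ n _ ?_ ?_) le_rfl fun R' h' => Run.copy ⟨?_, ?_⟩))))))) hb fun _ h => h
  · rintro j R₂ hj ⟨i1, i2, i3, i4⟩
    refine Run.seq (Run.const (Run.seq (Run.sub (Run.seq (Run.copy (Run.seq ?_))))))
    set R₃ := Function.update (Function.update (Function.update R₂ (d + 3) 1) (d + 1) (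
      Function.update R₂ (d + 3) 1 (d + 1) - Function.update R₂ (d + 3) 1 (d + 3))) x
      (Function.update (Function.update R₂ (d + 3) 1) (d + 1) (
      Function.update R₂ (d + 3) 1 (d + 1) - Function.update R₂ (d + 3) 1 (d + 3)) (d + 1))
      with hR₃
    have q : ∀ l, l ≠ x → l ≠ d + 1 → l ≠ d + 3 → R₃ l = R₂ l := by
      intro l h1 h2 h3
      rw [hR₃, Function.update_of_ne h1, Function.update_of_ne h2, Function.update_of_ne h3]
    have q1 : R₃ (d + 1) = j := by
      rw [hR₃, Function.update_of_ne (by omega)]; simp [hj]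
    have q2 : R₃ x = j := by
      rw [hR₃, Function.update_self]; simp [hj]
    have k : ∀ l < V, R₃ l = Function.update R x j l := by
      intro l hl
      by_cases h : l = x
      · subst h; rw [q2]; simp
      · rw [q l h (by omega) (by omega), Function.update_of_ne h, i4 l (by omega) h]
    have hja : j ≤ B ^ a := by omega
    have r := (He.2 χ hχ (d + 3) (by omega) R₃ (B ^ a) (hB.trans hB')
      fun l hl => by rw [k l hl]; exact hup j hja l hl).2
    rw [← pow_mul] at r
    refine r.mono le_rfl fun R₄ g₄ => Run.add ⟨?_, by omega, ?_, ?_, ?_⟩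
    · rw [Function.update_of_ne (by omega), g₄.2 _ (by omega), q1]
    · rw [Function.update_self, g₄.1, g₄.2 d (by omega), q d (by omega) (by omega) (by omega),
        eval_congr e he k]
      rw [Finset.sum_range_succ] at i2
      omega
    · rw [Function.update_of_ne (by omega), g₄.2 _ (by omega),
        q _ (by omega) (by omega) (by omega), i3]
    · intro l hl hlx
      have hl' := hl
      simp only [width] at hl'
      rw [Function.update_of_ne (by omega), g₄.2 _ (by omega),
        q _ (by omega) (by omega) (by omega), i4 l hl hlx]
  · rw [Function.update_of_ne (by omega), Function.update_of_ne (by omega), g₁.1]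
  · refine ⟨le_rfl, ?_, ?_, ?_⟩
    · rw [Function.update_of_ne (by omega), Function.update_self]
      simp [eval, hn]
    · rw [Function.update_self, Function.update_of_ne (by omega), g₁.2 x (by omega)]
    · intro j hj _
      simp only [width] at hj
      rw [Function.update_of_ne (by omega), Function.update_of_ne (by omega), g₁.2 j (by omega)]
  · rw [Function.update_of_ne (by omega)]
    simpa using h'.2.1
  · intro j hj
    by_cases h : j = x
    · subst h; rw [Function.update_self, h'.2.2.1]
    · rw [Function.update_of_ne h, h'.2.2.2 j hj h]

/-- Subtraction never lets the accumulator exceed its initial value, at most `B ^ a'`. Iteration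
therefore causes no repeated growth, and a fixed exponent suffices. -/
theorem spec_desc {V a b a' y : ℕ} {c e e₀ : Expr} (hy : y < V) (hc : Below V c) (he : Below V e)
    (Hc : Spec V c a) (Ha : Spec V e₀ a') (He : Spec V e b) :
    Spec V (.desc y c e₀ e) (a + a' + a' * b + a + 4) := by
  refine ⟨by omega, fun χ hχ d hd R B hB hR => ?_⟩
  have vc := (Hc.2 χ hχ (d + 1) (by omega) R B hB hR).1
  obtain ⟨va, ra⟩ := Ha.2 χ hχ d (by omega) R B hB hR
  have hB' : B ≤ B ^ a' := Nat.le_self_pow (by have := Ha.1; omega) B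
  have hup : ∀ i ≤ B ^ a', ∀ j < V, Function.update R y i j ≤ B ^ a' := by
    intro i hi j hj
    by_cases h : j = y
    · subst h; simpa using hi
    · rw [Function.update_of_ne h]; exact (hR j hj).trans hB'
  set n := eval χ c R with hn
  have hpos1 := one_le_pow_of_two_le hB a
  have hpos2 := one_le_pow_of_two_le hB (a' * b)
  have hpos3 := one_le_pow_of_two_le hB a'
  constructor
  · simp only [eval]
    calc _ ≤ eval χ e₀ R := iterate_desc_le _ _ _
      _ ≤ B ^ a' := va
      _ ≤ _ := Nat.pow_le_pow_right (by omega) (by omega)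
  have hb : B ^ a' + (B ^ a + (1 + (n * ((1 + (1 + (1 + (B ^ (a' * b) + 1)))) + 1) + 1 + 1))) ≤
      B ^ (a + a' + a' * b + a + 4) := by
    have h3 : 16 ≤ B ^ 4 := by
      calc 16 = 2 ^ 4 := by norm_num
        _ ≤ _ := Nat.pow_le_pow_left hB 4
    have hmain : n * B ^ (a' * b) ≤ B ^ a * B ^ (a' * b) := Nat.mul_le_mul_right _ vc
    have e1 : B ^ a ≤ B ^ (a + a' + a' * b + a) :=
      Nat.pow_le_pow_right (by omega) (by omega)
    have e2 : B ^ a' ≤ B ^ (a + a' + a' * b + a) :=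
      Nat.pow_le_pow_right (by omega) (by omega)
    have e3 : B ^ a * B ^ (a' * b) ≤ B ^ (a + a' + a' * b + a) := by
      rw [← pow_add]
      exact Nat.pow_le_pow_right (by omega) (by omega)
    rw [pow_add B _ 4]
    nlinarith
  refine Run.mono (Run.seq (ra.mono le_rfl fun R₀ g₀ => Run.seq ?_)) hb fun _ h => h
  have k₀ : ∀ j < V, R₀ j = R j := fun j hj => g₀.2 j (by omega)
  refine ((Hc.2 χ hχ (d + 1) (by omega) R₀ B hB
    fun j hj => by rw [k₀ j hj]; exact hR j hj).2).mono le_rfl fun R₁ g₁ => Run.seq (Run.copy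
    (Run.seq (Run.mono (Run.loop (Inv := fun j R' =>
      R' d ≤ B ^ a' ∧ (fun acc => acc - eval χ e (Function.update R y acc))^[j] (R' d)
        = eval χ (.desc y c e₀ e) R ∧ R' (d + 2) = R y ∧
      ∀ j, (j < d ∨ d + (Expr.desc y c e₀ e).width ≤ j) → j ≠ y → R' j = R j)
      ?_ n _ ?_ ?_) le_rfl fun R' h' => Run.copy ⟨?_, ?_⟩)))
  · rintro j R₂ hj ⟨i1, i2, i3, i4⟩
    refine Run.seq (Run.const (Run.seq (Run.sub (Run.seq (Run.copy (Run.seq ?_))))))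
    set R₃ := Function.update (Function.update (Function.update R₂ (d + 3) 1) (d + 1) (
      Function.update R₂ (d + 3) 1 (d + 1) - Function.update R₂ (d + 3) 1 (d + 3))) y
      (Function.update (Function.update R₂ (d + 3) 1) (d + 1) (
      Function.update R₂ (d + 3) 1 (d + 1) - Function.update R₂ (d + 3) 1 (d + 3)) d)
      with hR₃
    have q : ∀ l, l ≠ y → l ≠ d + 1 → l ≠ d + 3 → R₃ l = R₂ l := by
      intro l h1 h2 h3
      rw [hR₃, Function.update_of_ne h1, Function.update_of_ne h2, Function.update_of_ne h3]
    have q1 : R₃ (d + 1) = j := by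
      rw [hR₃, Function.update_of_ne (by omega)]; simp [hj]
    have q2 : R₃ y = R₂ d := by
      rw [hR₃, Function.update_self, Function.update_of_ne (by omega),
        Function.update_of_ne (by omega)]
    have k : ∀ l < V, R₃ l = Function.update R y (R₂ d) l := by
      intro l hl
      by_cases h : l = y
      · subst h; rw [q2]; simp
      · rw [q l h (by omega) (by omega), Function.update_of_ne h, i4 l (by omega) h]
    have r := (He.2 χ hχ (d + 3) (by omega) R₃ (B ^ a') (hB.trans hB')
      fun l hl => by rw [k l hl]; exact hup _ i1 l hl).2
    rw [← pow_mul] at r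
    refine r.mono le_rfl fun R₄ g₄ => Run.sub ⟨?_, ?_, ?_, ?_, ?_⟩
    · rw [Function.update_of_ne (by omega), g₄.2 _ (by omega), q1]
    · rw [Function.update_self, g₄.2 d (by omega), q d (by omega) (by omega) (by omega)]
      omega
    · rw [Function.update_self, g₄.1, g₄.2 d (by omega), q d (by omega) (by omega) (by omega),
        eval_congr e he k, ← i2, Function.iterate_succ_apply]
    · rw [Function.update_of_ne (by omega), g₄.2 _ (by omega),
        q _ (by omega) (by omega) (by omega), i3]
    · intro l hl hlx
      have hl' := hl
      simp only [width] at hl'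
      rw [Function.update_of_ne (by omega), g₄.2 _ (by omega),
        q _ (by omega) (by omega) (by omega), i4 l hl hlx]
  · rw [Function.update_of_ne (by omega), g₁.1, eval_congr c hc k₀]
  · refine ⟨?_, ?_, ?_, ?_⟩
    · rw [Function.update_of_ne (by omega), g₁.2 d (by omega), g₀.1]; exact va
    · rw [Function.update_of_ne (by omega), g₁.2 d (by omega), g₀.1]
      simp [eval, hn]
    · rw [Function.update_self, g₁.2 y (by omega), g₀.2 y (by omega)]
    · intro j hj _
      simp only [width] at hj
      rw [Function.update_of_ne (by omega), g₁.2 j (by omega), g₀.2 j (by omega)]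
  · rw [Function.update_of_ne (by omega)]
    simpa using h'.2.1
  · intro j hj
    by_cases h : j = y
    · subst h; rw [Function.update_self, h'.2.2.1]
    · rw [Function.update_of_ne h, h'.2.2.2 j hj h]

theorem exists_spec {V : ℕ} (e : Expr) (he : Below V e) : ∃ a, Spec V e a := by
  induction e with
  | var x =>
    refine ⟨1, le_rfl, fun χ _ d hd R B hB hR => ⟨by simpa [eval] using hR x he, ?_⟩⟩
    refine (Run.copy ⟨by simp [eval], fun j hj => ?_⟩).mono (one_le_pow_of_two_le hB 1) fun _ h => h
    simp only [width] at hj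
    rw [Function.update_of_ne (by omega)]
  | const c =>
    -- A constant is bounded through `c ≤ 2 ^ c ≤ B ^ (c + 1)`; the extra `1` makes the exponent
    -- positive also for `c = 0`.
    refine ⟨c + 1, by omega, fun χ _ d hd R B hB hR => ⟨?_, ?_⟩⟩
    · calc c ≤ 2 ^ c := Nat.lt_two_pow_self.le
        _ ≤ 2 ^ (c + 1) := Nat.pow_le_pow_right (by omega) (by omega)
        _ ≤ _ := Nat.pow_le_pow_left hB _
    · refine (Run.const ⟨by simp [eval], fun j hj => ?_⟩).mono (one_le_pow_of_two_le hB _)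
        fun _ h => h
      simp only [width] at hj
      rw [Function.update_of_ne (by omega)]
  | add a b iha ihb =>
    obtain ⟨a', ha⟩ := iha he.1
    obtain ⟨b', hb⟩ := ihb he.2
    exact ⟨_, spec_binary he.2 ha hb (.inl rfl)⟩
  | sub a b iha ihb =>
    obtain ⟨a', ha⟩ := iha he.1
    obtain ⟨b', hb⟩ := ihb he.2
    exact ⟨_, spec_binary he.2 ha hb (.inr rfl)⟩
  | query a b c iha ihb ihc =>
    obtain ⟨a', ha⟩ := iha he.1
    obtain ⟨b', hb⟩ := ihb he.2.1
    obtain ⟨c', hc⟩ := ihc he.2.2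
    exact ⟨_, spec_query he.2.1 he.2.2 ha hb hc⟩
  | sum x c e ihc ihe =>
    obtain ⟨a', ha⟩ := ihc he.2.1
    obtain ⟨b', hb⟩ := ihe he.2.2
    exact ⟨_, spec_sum he.1 he.2.2 ha hb⟩
  | desc y c a e ihc iha ihe =>
    obtain ⟨c', hc⟩ := ihc he.2.1
    obtain ⟨a', ha⟩ := iha he.2.2.1
    obtain ⟨b', hb⟩ := ihe he.2.2.2
    exact ⟨_, spec_desc he.1 he.2.1 he.2.2.2 hc ha hb⟩

end Expr
end PointPatterns

namespace PointPatterns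
namespace Expr

/-! ### Truth values -/

variable {χ : ℕ → ℕ → ℕ → ℕ}

def notE (a : Expr) : Expr := .sub (.const 1) a
def leE (a b : Expr) : Expr := notE (.sub a b)
def ltE (a b : Expr) : Expr := leE (.add a (.const 1)) b
def eqE (a b : Expr) : Expr := notE (.add (.sub a b) (.sub b a))
def andE (a b : Expr) : Expr := notE (.add (notE a) (notE b))
def orE (a b : Expr) : Expr := notE (notE (.add a b))
def exE (x : ℕ) (c e : Expr) : Expr := notE (notE (.sum x c e))
/-- The number of `x` below `c` for which `e` does not vanish. -/
def countE (x : ℕ) (c e : Expr) : Expr := .sum x c (notE (notE e))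
/-- Conjunction of a list of expressions. -/
def allE : List Expr → Expr
  | [] => .const 1
  | e :: l => andE e (allE l)
/-- Disjunction of a list of expressions. -/
def anyE : List Expr → Expr
  | [] => .const 0
  | e :: l => orE e (anyE l)
/-- Existential quantification over several variables with given bounds. -/
def exList : List (ℕ × Expr) → Expr → Expr
  | [], e => e
  | xb :: l, e => exE xb.1 xb.2 (exList l e)

section eval
variable (a b c e : Expr) (x : ℕ) (R : Memory) (l : List Expr)

theorem eval_notE : eval χ (notE a) R = if eval χ a R = 0 then 1 else 0 := by
  simp only [notE, eval]; split_ifs <;> omega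
theorem eval_notE_le : eval χ (notE a) R ≤ 1 := by simp only [notE, eval]; omega
@[simp] theorem notE_ne_zero : eval χ (notE a) R ≠ 0 ↔ ¬ eval χ a R ≠ 0 := by
  simp only [notE, eval]; omega
@[simp] theorem leE_ne_zero : eval χ (leE a b) R ≠ 0 ↔ eval χ a R ≤ eval χ b R := by
  simp only [leE, notE, eval]; omega
@[simp] theorem ltE_ne_zero : eval χ (ltE a b) R ≠ 0 ↔ eval χ a R < eval χ b R := by
  simp only [ltE, leE, notE, eval]; omega
@[simp] theorem eqE_ne_zero : eval χ (eqE a b) R ≠ 0 ↔ eval χ a R = eval χ b R := by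
  simp only [eqE, notE, eval]; omega
@[simp] theorem andE_ne_zero :
    eval χ (andE a b) R ≠ 0 ↔ eval χ a R ≠ 0 ∧ eval χ b R ≠ 0 := by
  simp only [andE, notE, eval]; omega
theorem eval_andE_le : eval χ (andE a b) R ≤ 1 := eval_notE_le _ _
@[simp] theorem orE_ne_zero :
    eval χ (orE a b) R ≠ 0 ↔ eval χ a R ≠ 0 ∨ eval χ b R ≠ 0 := by
  simp only [orE, notE, eval]; omega
@[simp] theorem exE_ne_zero : eval χ (exE x c e) R ≠ 0 ↔
    ∃ i < eval χ c R, eval χ e (Function.update R x i) ≠ 0 := by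
  rw [exE, notE_ne_zero, notE_ne_zero, not_not, eval, Ne, Finset.sum_eq_zero_iff]
  simp
@[simp] theorem eval_countE : eval χ (countE x c e) R =
    ((Finset.range (eval χ c R)).filter fun i => eval χ e (Function.update R x i) ≠ 0).card := by
  rw [countE, eval, Finset.card_filter]
  refine Finset.sum_congr rfl fun i _ => ?_
  rw [eval_notE, eval_notE]
  split_ifs <;> simp_all
@[simp] theorem allE_ne_zero : eval χ (allE l) R ≠ 0 ↔ ∀ e ∈ l, eval χ e R ≠ 0 := by
  induction l with
  | nil => simp [allE, eval]
  | cons e l ih => rw [allE, andE_ne_zero, ih]; simp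
@[simp] theorem anyE_ne_zero : eval χ (anyE l) R ≠ 0 ↔ ∃ e ∈ l, eval χ e R ≠ 0 := by
  induction l with
  | nil => simp [anyE, eval]
  | cons e l ih => rw [anyE, orE_ne_zero, ih]; simp
end eval

section below
variable {V : ℕ} {a b c e : Expr} {x : ℕ} {l : List Expr}
@[simp] theorem below_notE : Below V (notE a) ↔ Below V a := by simp [notE, Below]
@[simp] theorem below_leE : Below V (leE a b) ↔ Below V a ∧ Below V b := by simp [leE, Below]
@[simp] theorem below_ltE : Below V (ltE a b) ↔ Below V a ∧ Below V b := by simp [ltE, Below]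
@[simp] theorem below_eqE : Below V (eqE a b) ↔ Below V a ∧ Below V b := by
  simp only [eqE, Below, below_notE]; tauto
@[simp] theorem below_andE : Below V (andE a b) ↔ Below V a ∧ Below V b := by simp [andE, Below]
@[simp] theorem below_orE : Below V (orE a b) ↔ Below V a ∧ Below V b := by simp [orE, Below]
@[simp] theorem below_exE : Below V (exE x c e) ↔ x < V ∧ Below V c ∧ Below V e := by
  simp [exE, Below]
@[simp] theorem below_countE : Below V (countE x c e) ↔ x < V ∧ Below V c ∧ Below V e := by
  simp [countE, Below]
@[simp] theorem below_allE : Below V (allE l) ↔ ∀ e ∈ l, Below V e := by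
  induction l with
  | nil => simp [allE, Below]
  | cons e l ih => simp [allE, ih]
@[simp] theorem below_anyE : Below V (anyE l) ↔ ∀ e ∈ l, Below V e := by
  induction l with
  | nil => simp [anyE, Below]
  | cons e l ih => simp [anyE, ih]
theorem below_exList {l : List (ℕ × Expr)} : Below V (exList l e) ↔
    (∀ xb ∈ l, xb.1 < V ∧ Below V xb.2) ∧ Below V e := by
  induction l with
  | nil => simp [exList]
  | cons xb l ih => simp [exList, ih, and_assoc]

theorem Below.mono {V' : ℕ} (h : Below V e) (hV : V ≤ V') : Below V' e := by
  induction e with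
  | var x => exact lt_of_lt_of_le h hV
  | const c => trivial
  | add a b iha ihb => exact ⟨iha h.1, ihb h.2⟩
  | sub a b iha ihb => exact ⟨iha h.1, ihb h.2⟩
  | query a b c iha ihb ihc => exact ⟨iha h.1, ihb h.2.1, ihc h.2.2⟩
  | sum x c e ihc ihe => exact ⟨h.1.trans_le hV, ihc h.2.1, ihe h.2.2⟩
  | desc y c a e ihc iha ihe => exact ⟨h.1.trans_le hV, ihc h.2.1, iha h.2.2.1, ihe h.2.2.2⟩

end below

theorem eval_update_of_below {m x i : ℕ} {b : Expr} (hb : Below m b) (hx : m ≤ x) (R : Memory) :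
    eval χ b (Function.update R x i) = eval χ b R :=
  eval_congr _ hb fun j hj => by rw [Function.update_of_ne (by omega)]

/-- The quantified variables are at least `m` and the bounds only involve registers below `m`, so
the nested quantifiers may choose all values at once, against bounds evaluated in the original
memory. -/
theorem exList_ne_zero {m : ℕ} (l : List (ℕ × Expr)) (e : Expr) (R : Memory)
    (hn : (l.map Prod.fst).Nodup) (hl : ∀ xb ∈ l, m ≤ xb.1 ∧ Below m xb.2) :
    eval χ (exList l e) R ≠ 0 ↔ ∃ R', (∀ j, (∀ xb ∈ l, j ≠ xb.1) → R' j = R j) ∧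
      (∀ xb ∈ l, R' xb.1 < eval χ xb.2 R) ∧ eval χ e R' ≠ 0 := by
  induction l generalizing R with
  | nil =>
    refine ⟨fun h => ⟨R, fun _ _ => rfl, by simp, h⟩, fun ⟨R', h1, _, h2⟩ => ?_⟩
    rwa [show R' = R from funext fun j => h1 j (by simp)] at h2
  | cons xb l ih =>
    have hxb := hl xb List.mem_cons_self
    rw [List.map_cons, List.nodup_cons] at hn
    have hl' : ∀ yb ∈ l, m ≤ yb.1 ∧ Below m yb.2 := fun yb h => hl yb (List.mem_cons_of_mem _ h)
    have hne : ∀ yb ∈ l, xb.1 ≠ yb.1 := fun yb h h' =>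
      hn.1 (List.mem_map.2 ⟨yb, h, h'.symm⟩)
    have hev : ∀ i, ∀ yb ∈ l, eval χ yb.2 (Function.update R xb.1 i) = eval χ yb.2 R :=
      fun i yb hyb => eval_update_of_below (hl' yb hyb).2 hxb.1 R
    rw [exList, exE_ne_zero]
    constructor
    · rintro ⟨i, hi, h⟩
      obtain ⟨R', h1, h2, h3⟩ := (ih _ hn.2 hl').1 h
      refine ⟨R', fun j hj => ?_, fun yb hyb => ?_, h3⟩
      · rw [h1 j fun yb hyb => hj yb (List.mem_cons_of_mem _ hyb),
          Function.update_of_ne (hj xb List.mem_cons_self)]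
      · rcases List.mem_cons.1 hyb with rfl | hyb
        · rw [h1 _ hne, Function.update_self]; exact hi
        · rw [← hev i yb hyb]; exact h2 yb hyb
    · rintro ⟨R', h1, h2, h3⟩
      refine ⟨R' xb.1, h2 xb List.mem_cons_self, (ih _ hn.2 hl').2 ⟨R', fun j hj => ?_,
        fun yb hyb => ?_, h3⟩⟩
      · by_cases hjx : j = xb.1
        · subst hjx; simp
        · rw [Function.update_of_ne hjx, h1]
          intro yb hyb
          rcases List.mem_cons.1 hyb with rfl | hyb
          exacts [hjx, hj yb hyb]
      · rw [hev _ yb hyb]; exact h2 yb (List.mem_cons_of_mem _ hyb)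

/-- The least `x` below `b` for which `e` does not vanish; `y` is an auxiliary variable. -/
def muE (y x : ℕ) (b e : Expr) : Expr := .desc y b b (exE x (.var y) e)

theorem eval_muE_le (y x : ℕ) (b e : Expr) (R : Memory) :
    eval χ (muE y x b e) R ≤ eval χ b R := by
  rw [muE, eval]; exact iterate_desc_le _ _ _

/-- With `w` the least witness, the subtracted term at `acc` is `1` exactly when `w < acc`. The
descent from the bound thus goes down by one until it reaches `w` and rests there. -/
theorem eval_muE {y x : ℕ} {b e : Expr} {R : Memory} (hy : x < y) (he : Below y e)
    (h : eval χ (exE x b e) R ≠ 0) :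
    eval χ e (Function.update R x (eval χ (muE y x b e) R)) ≠ 0 := by
  classical
  rw [exE_ne_zero] at h
  have hw := Nat.find_spec h
  have hmin : ∀ i < Nat.find h, ¬ eval χ e (Function.update R x i) ≠ 0 := fun i hi hc =>
    Nat.find_min h hi ⟨hi.trans hw.1, hc⟩
  set w := Nat.find h with hwdef
  have hcond : ∀ acc, eval χ (exE x (.var y) e) (Function.update R y acc) =
      if w < acc then 1 else 0 := by
    intro acc
    have h1 : eval χ (exE x (.var y) e) (Function.update R y acc) ≠ 0 ↔ w < acc := by
      rw [exE_ne_zero]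
      have hev : ∀ i, eval χ e (Function.update (Function.update R y acc) x i) =
          eval χ e (Function.update R x i) := fun i => by
        rw [Function.update_comm (by omega)]
        exact eval_update_of_below he le_rfl _
      simp only [hev, eval, Function.update_self]
      constructor
      · rintro ⟨i, hi, hc⟩
        by_contra hlt
        exact hmin i (by omega) hc
      · exact fun hlt => ⟨w, hlt, hw.2⟩
    have h2 : eval χ (exE x (.var y) e) (Function.update R y acc) ≤ 1 := eval_notE_le _ _
    split_ifs with h3
    · have := h1.2 h3; omega
    · by_contra hc; exact h3 (h1.1 hc)
  have hit : ∀ n acc, w ≤ acc →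
      (fun acc => acc - eval χ (exE x (.var y) e) (Function.update R y acc))^[n] acc =
        max (acc - n) w := by
    intro n
    induction n with
    | zero => intro acc hacc; simp [hacc]
    | succ n ih =>
      intro acc hacc
      rw [Function.iterate_succ_apply, hcond, ih]
      · split_ifs <;> omega
      · split_ifs <;> omega
  rw [muE, eval, hit _ _ hw.1.le]
  simpa using hw.2

/-! ### Program fragments -/

/-- `R[x] := e`. -/
def assign (V x : ℕ) (e : Expr) : Program := .seq (compile e V) (.copy x V)

theorem run_assign {V x : ℕ} {e : Expr} (he : Below V e) (hx : x < V) :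
    ∃ a, ∀ (χ : ℕ → ℕ → ℕ → ℕ), (∀ i j l, χ i j l ≤ 2) → ∀ (R : Memory) (B : ℕ),
      2 ≤ B → (∀ j < V, R j ≤ B) → Run χ (assign V x e) R (B ^ a) fun R' =>
        ∀ j < V, R' j = Function.update R x (eval χ e R) j := by
  obtain ⟨a, ha⟩ := exists_spec e he
  refine ⟨a + 1, fun χ hχ R B hB hR => ?_⟩
  refine Run.mono (Run.seq ((ha.2 χ hχ V le_rfl R B hB hR).2.mono le_rfl fun R' h' =>
    Run.copy (Q := fun R' => ∀ j < V, R' j = Function.update R x (eval χ e R) j) ?_)) ?_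
    fun _ h => h
  · intro j hj
    by_cases h : j = x
    · subst h; simp [h'.1]
    · rw [Function.update_of_ne h, Function.update_of_ne h, h'.2 j (by omega)]
  · have := one_le_pow_of_two_le hB a
    rw [pow_succ]; nlinarith

/-- `R[x] := 2 ^ e`. -/
def assignPow (V x : ℕ) (e : Expr) : Program :=
  .seq (compile e V) (.seq (.const x 1) (.loop V (.seq (.add x x x)
    (.seq (.const (V + 1) 1) (.sub V V (V + 1))))))

/-- Expressions have polynomially bounded values, so exponentials need a program of their own.
Doubling keeps the running time polynomial in `B`, although the result need not be. -/
theorem run_assignPow {V x : ℕ} {e : Expr} (he : Below V e) (hx : x < V) :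
    ∃ a, ∀ (χ : ℕ → ℕ → ℕ → ℕ), (∀ i j l, χ i j l ≤ 2) → ∀ (R : Memory) (B : ℕ),
      2 ≤ B → (∀ j < V, R j ≤ B) → Run χ (assignPow V x e) R (B ^ a) fun R' =>
        ∀ j < V, R' j = Function.update R x (2 ^ eval χ e R) j := by
  obtain ⟨a, ha⟩ := exists_spec e he
  refine ⟨a + 3, fun χ hχ R B hB hR => ?_⟩
  obtain ⟨hv, hr⟩ := ha.2 χ hχ V le_rfl R B hB hR
  refine Run.mono (Run.seq (hr.mono le_rfl fun R₁ h₁ => Run.seq (Run.const (Run.mono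
    (Run.loop (T := 1 + (1 + 1)) (Inv := fun j R' => R' x * 2 ^ j = 2 ^ eval χ e R ∧
      ∀ l < V, l ≠ x → R' l = R l) ?_ (eval χ e R) _ ?_ ?_) le_rfl
    fun R' h' j hj => ?_)))) ?_ fun _ h => h
  · rintro j R₂ hj ⟨i1, i2⟩
    refine Run.seq (Run.add (Run.seq (Run.const (Run.sub ⟨?_, ?_, ?_⟩))))
    · rw [Function.update_self, Function.update_self, Function.update_of_ne (by omega),
        Function.update_of_ne (by omega)]
      omega
    · rw [Function.update_of_ne (by omega), Function.update_of_ne (by omega),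
        Function.update_self, ← i1, pow_succ]
      ring
    · intro l hl hlx
      rw [Function.update_of_ne (by omega), Function.update_of_ne (by omega),
        Function.update_of_ne (by omega), i2 l hl hlx]
  · rw [Function.update_of_ne (by omega), h₁.1]
  · refine ⟨by simp, fun l hl hlx => ?_⟩
    rw [Function.update_of_ne hlx, h₁.2 l (by omega)]
  · by_cases h : j = x
    · subst h; simpa using h'.1
    · rw [Function.update_of_ne h, h'.2 j hj h]
  · have := one_le_pow_of_two_le hB a
    have h3 : 8 ≤ B ^ 3 := Nat.pow_le_pow_left hB 3
    rw [pow_add]; nlinarith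

/-- Search for values of the variables in `l` for which `e` does not vanish. -/
def search (V : ℕ) : List (ℕ × Expr) → Expr → Program
  | [], _ => .skip
  | xb :: l, e => .seq (assign (V + 1) xb.1 (muE V xb.1 xb.2 (exList l e))) (search V l e)

/-- Self-reduction: each variable in turn receives the least value for which the remaining ones can
still be completed. Without a solution the values are meaningless but stay within their bounds, so
the registers remain bounded by `B` in either case. -/
theorem run_search {V m : ℕ} (l : List (ℕ × Expr)) (e : Expr) (he : Below V e) (hm : m ≤ V)
    (hl : ∀ xb ∈ l, m ≤ xb.1 ∧ xb.1 < V ∧ Below m xb.2) :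
    ∃ a, ∀ (χ : ℕ → ℕ → ℕ → ℕ), (∀ i j l, χ i j l ≤ 2) → ∀ (R : Memory) (B : ℕ),
      2 ≤ B → (∀ j < V + 1, R j ≤ B) → (∀ xb ∈ l, eval χ xb.2 R ≤ B) →
      Run χ (search V l e) R (B ^ a) fun R' => (∀ j < V + 1, R' j ≤ B) ∧
        (∀ j < V + 1, (∀ xb ∈ l, j ≠ xb.1) → R' j = R j) ∧
        (eval χ (exList l e) R ≠ 0 → eval χ e R' ≠ 0) := by
  induction l with
  | nil =>
    refine ⟨0, fun χ hχ R B hB hR _ => ⟨1, R, .skip R, by simp, hR, fun _ _ _ => rfl, ?_⟩⟩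
    exact fun h => h
  | cons xb l ih =>
    have hxb := hl xb List.mem_cons_self
    have hl' : ∀ yb ∈ l, m ≤ yb.1 ∧ yb.1 < V ∧ Below m yb.2 :=
      fun yb h => hl yb (List.mem_cons_of_mem _ h)
    obtain ⟨a, ha⟩ := ih hl'
    have heB : Below V (exList l e) :=
      below_exList.2 ⟨fun yb hyb => ⟨(hl' yb hyb).2.1, (hl' yb hyb).2.2.mono hm⟩, he⟩
    have hmu : Below (V + 1) (muE V xb.1 xb.2 (exList l e)) := by
      have h1 := hxb.2.2.mono (show m ≤ V + 1 by omega)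
      simp only [muE, Below, below_exE]
      exact ⟨by omega, h1, h1, by omega, by omega, heB.mono (by omega)⟩
    obtain ⟨b, hb⟩ := run_assign hmu (show xb.1 < V + 1 by omega)
    refine ⟨a + b + 1, fun χ hχ R B hB hR hbd => ?_⟩
    have hmono : B ^ b + B ^ a ≤ B ^ (a + b + 1) := by
      have h1 := one_le_pow_of_two_le hB a
      have h2 := one_le_pow_of_two_le hB b
      rw [pow_succ, pow_add]
      have : B ^ a * B ^ b * 2 ≤ B ^ a * B ^ b * B := Nat.mul_le_mul_left _ hB
      nlinarith
    refine Run.mono (Run.seq ((hb χ hχ R B hB hR).mono le_rfl fun R₁ h₁ => ?_)) hmono fun _ h => h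
    have hcong : ∀ j < m, R₁ j = R j := fun j hj => by
      rw [h₁ j (by omega), Function.update_of_ne (by omega)]
    refine (ha χ hχ R₁ B hB ?_ ?_).mono le_rfl ?_
    · intro j hj
      rw [h₁ j hj]
      by_cases h : j = xb.1
      · subst h
        rw [Function.update_self]
        exact (eval_muE_le _ _ _ _ _).trans (hbd xb List.mem_cons_self)
      · rw [Function.update_of_ne h]; exact hR j hj
    · intro yb hyb
      rw [eval_congr _ (hl' yb hyb).2.2 hcong]
      exact hbd yb (List.mem_cons_of_mem _ hyb)
    · rintro R' ⟨h2, h3, h4⟩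
      refine ⟨h2, fun j hj hjl => ?_, fun h => h4 ?_⟩
      · rw [h3 j hj fun yb hyb => hjl yb (List.mem_cons_of_mem _ hyb), h₁ j hj,
          Function.update_of_ne (hjl xb List.mem_cons_self)]
      · rw [eval_congr _ heB fun j hj => h₁ j (by omega)]
        exact eval_muE hxb.2.1 heB h

/-- List all `x` below `R[0]` for which `e` is `1`, and copy register `12` to register `2`. -/
def output (V x : ℕ) (e : Expr) : Program :=
  .seq (.const V 0) (.seq (.copy (V + 1) 0) (.seq
    (.loop (V + 1) (.seq (.const (V + 2) 1) (.seq (.sub (V + 1) (V + 1) (V + 2))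
      (.seq (.copy x (V + 1)) (.seq (compile e (V + 2)) (.seq (.const (V + 3) (V + 4 + e.width))
        (.seq (.add (V + 3) (V + 3) V) (.seq (.store (V + 3) x) (.add V V (V + 2))))))))))
    (.seq (.copy 2 12) (.seq (.copy 0 V) (.const 1 (V + 4 + e.width))))))

/-- Every index is stored at the end of the list without a test, and the length then grows by the
value `0` or `1` of `e`. A rejected index is overwritten by the next one. The list starts at `W`,
beyond all scratch registers. -/
theorem run_output {V x : ℕ} {e : Expr} (he : Below V e) (hx : x < V) (hx0 : 12 < x)  :
    ∃ a, ∀ (χ : ℕ → ℕ → ℕ → ℕ), (∀ i j l, χ i j l ≤ 2) → ∀ (R : Memory) (B : ℕ),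
      (∀ R, eval χ e R ≤ 1) →
      2 ≤ B → (∀ j < V, R j ≤ B) → Run χ (output V x e) R (B ^ a) fun R' =>
        R' 2 = R 12 ∧ (((List.range (R' 0)).map fun j => R' (R' 1 + j) : List ℕ) : Multiset ℕ) =
          (Multiset.range (R 0)).filter fun i => eval χ e (Function.update R x i) ≠ 0 := by
  obtain ⟨a, ha⟩ := exists_spec e he
  refine ⟨a + 6, fun χ hχ R B he1 hB hR => ?_⟩
  have hw := e.width_pos
  set W := V + 4 + e.width with hW
  let M : ℕ → Multiset ℕ := fun n =>
    (Multiset.range n).filter fun i => eval χ e (Function.update R x i) ≠ 0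
  have hn : R 0 ≤ B := hR 0 (by omega)
  refine Run.mono (Run.seq (Run.const (Run.seq (Run.copy (Run.seq (Run.mono (Run.loop
    (T := 1 + (1 + (1 + (B ^ a + (1 + (1 + (1 + 1))))))) (Inv := fun j R' => j ≤ R 0 ∧
      (∀ l < V, l ≠ x → R' l = R l) ∧
      (((List.range (R' V)).map fun j => R' (W + j) : List ℕ) : Multiset ℕ) + M j = M (R 0))
    ?_ (R 0) _ ?_ ?_) le_rfl fun R' h' => Run.seq (Run.copy (Run.seq (Run.copy
    (Run.const ⟨?_, ?_⟩)))))))))) ?_ fun _ h => h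
  · rintro j R₂ hj ⟨i1, i2, i3⟩
    refine Run.seq (Run.const (Run.seq (Run.sub (Run.seq (Run.copy (Run.seq ?_))))))
    set R₃ := Function.update (Function.update (Function.update R₂ (V + 2) 1) (V + 1) (
      Function.update R₂ (V + 2) 1 (V + 1) - Function.update R₂ (V + 2) 1 (V + 2))) x
      (Function.update (Function.update R₂ (V + 2) 1) (V + 1) (
      Function.update R₂ (V + 2) 1 (V + 1) - Function.update R₂ (V + 2) 1 (V + 2)) (V + 1))
      with hR₃
    have q : ∀ l, l ≠ x → l ≠ V + 1 → l ≠ V + 2 → R₃ l = R₂ l := by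
      intro l h1 h2 h3
      rw [hR₃, Function.update_of_ne h1, Function.update_of_ne h2, Function.update_of_ne h3]
    have q1 : R₃ (V + 1) = j := by
      rw [hR₃, Function.update_of_ne (by omega)]; simp [hj]
    have q2 : R₃ x = j := by
      rw [hR₃, Function.update_self]; simp [hj]
    have k : ∀ l < V, R₃ l = Function.update R x j l := by
      intro l hl
      by_cases h : l = x
      · subst h; rw [q2]; simp
      · rw [q l h (by omega) (by omega), Function.update_of_ne h, i2 l (by omega) h]
    have hle : ∀ l < V, R₃ l ≤ B := by
      intro l hl
      rw [k l hl]
      by_cases h : l = x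
      · subst h; rw [Function.update_self]; omega
      · rw [Function.update_of_ne h]; exact hR l hl
    have hev := eval_congr (χ := χ) e he k
    refine (ha.2 χ hχ (V + 2) (by omega) R₃ B hB hle).2.mono le_rfl fun R₄ g₄ => ?_
    refine Run.seq (Run.const (Run.seq (Run.add (Run.seq (Run.store (Run.add ?_))))))
    have w : ∀ l, l ≠ x → l < V + 2 ∨ W ≤ l → l ≠ V + 1 → R₄ l = R₂ l := by
      intro l hlx hl hl1
      rw [g₄.2 l (by omega), q l hlx hl1 (by omega)]
    have wV : R₄ V = R₂ V := w V (by omega) (by omega) (by omega)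
    have wx : R₄ x = j := by rw [g₄.2 x (by omega), q2]
    have wd : R₄ (V + 2) = eval χ e (Function.update R x j) := by rw [g₄.1, hev]
    simp only [Function.update_self, Function.update_of_ne (show V ≠ V + 3 by omega),
      Function.update_of_ne (show x ≠ V + 3 by omega), wV, wx]
    have hV0 : Function.update (Function.update (Function.update R₄ (V + 3) W) (V + 3)
        (W + R₂ V)) (W + R₂ V) j V = R₂ V := by
      rw [Function.update_of_ne (by omega), Function.update_of_ne (by omega),
        Function.update_of_ne (by omega), wV]
    have hV2 : Function.update (Function.update (Function.update R₄ (V + 3) W) (V + 3)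
        (W + R₂ V)) (W + R₂ V) j (V + 2) = eval χ e (Function.update R x j) := by
      rw [Function.update_of_ne (by omega), Function.update_of_ne (by omega),
        Function.update_of_ne (by omega), wd]
    rw [hV0, hV2]
    refine ⟨?_, by omega, ?_, ?_⟩
    · rw [Function.update_of_ne (by omega), Function.update_of_ne (by omega),
        Function.update_of_ne (by omega), Function.update_of_ne (by omega), g₄.2 _ (by omega), q1]
    · intro l hl hlx
      rw [Function.update_of_ne (by omega), Function.update_of_ne (by omega),
        Function.update_of_ne (by omega), Function.update_of_ne (by omega),
        w l hlx (by omega) (by omega), i2 l hl hlx]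
    · have hmap : ∀ c, (List.range (R₂ V)).map (fun i => Function.update (Function.update
          (Function.update (Function.update R₄ (V + 3) W) (V + 3) (W + R₂ V)) (W + R₂ V) j) V c
            (W + i)) = (List.range (R₂ V)).map fun i => R₂ (W + i) := by
        intro c
        refine List.map_congr_left fun i hi => ?_
        have := List.mem_range.1 hi
        rw [Function.update_of_ne (by omega), Function.update_of_ne (by omega),
          Function.update_of_ne (by omega), Function.update_of_ne (by omega),
          w _ (by omega) (by omega) (by omega)]
      have hM : M (j + 1) = M j + if eval χ e (Function.update R x j) ≠ 0 then {j} else 0 := by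
        simp only [M, Multiset.range_succ, Multiset.filter_cons]
        rw [add_comm]
      rw [← i3, hM, ← hW]
      rcases Nat.le_one_iff_eq_zero_or_eq_one.1 (he1 (Function.update R x j)) with h0 | h1
      · simp only [h0, add_zero, hmap]; simp
      · rw [h1, List.range_succ, List.map_append, hmap, ← Multiset.coe_add]
        simp only [List.map_cons, List.map_nil]
        rw [Function.update_of_ne (by omega), Function.update_self]
        simp only [ne_eq, one_ne_zero, not_false_eq_true, if_true, Multiset.coe_singleton]
        abel
  · rw [Function.update_self, Function.update_of_ne (by omega)]
  · refine ⟨le_rfl, fun l hl hlx => ?_, ?_⟩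
    · rw [Function.update_of_ne (by omega), Function.update_of_ne (by omega)]
    · have h0 : Function.update (Function.update R V 0) (V + 1) (Function.update R V 0 0) V = 0 := by
        rw [Function.update_of_ne (by omega), Function.update_self]
      rw [h0]
      simp
  · have h1 := one_le_pow_of_two_le hB a
    have h2 : 64 ≤ B ^ 6 := Nat.pow_le_pow_left hB 6
    have h3 : B ^ 6 = B * B ^ 5 := by ring
    have h4 : 32 ≤ B ^ 5 := Nat.pow_le_pow_left hB 5
    have h5 : R 0 * B ^ a ≤ B * B ^ a := Nat.mul_le_mul_right _ hn
    have h6 : B * B ^ a * 32 ≤ B * B ^ a * B ^ 5 := Nat.mul_le_mul_left _ h4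
    have h7 : B ≤ B * B ^ a := Nat.le_mul_of_pos_right _ h1
    rw [pow_add, h3]
    nlinarith
  · rw [Function.update_of_ne (by omega), Function.update_of_ne (by omega),
      Function.update_self, h'.2.1 12 (by omega) (by omega)]
  · have := h'.2.2
    simp only [M, Multiset.range_zero, Multiset.filter_zero, add_zero] at this
    have h0 : Function.update (Function.update (Function.update R' 2 (R' 12)) 0
        (Function.update R' 2 (R' 12) V)) 1 W 0 = R' V := by
      rw [Function.update_of_ne (by omega), Function.update_self, Function.update_of_ne (by omega)]
    rw [← this, ← hW, h0, Function.update_self]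
    congr 1
    refine List.map_congr_left fun i _ => ?_
    rw [Function.update_of_ne (by omega), Function.update_of_ne (by omega),
      Function.update_of_ne (by omega)]

end Expr
end PointPatterns

namespace PointPatterns

/-! ### Collinearity and convex position -/

/-- The determinant whose sign is the orientation. -/
def det (a b c : Plane) : ℝ := (b 0 - a 0) * (c 1 - a 1) - (b 1 - a 1) * (c 0 - a 0)

theorem orientation_eq (a b c : Plane) : orientation a b c = SignType.sign (det a b c) := rfl

theorem orientation_eq_zero {a b c : Plane} : orientation a b c = 0 ↔ det a b c = 0 := by
  rw [orientation_eq, sign_eq_zero_iff]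

theorem det_swap_left (a b c : Plane) : det b a c = -det a b c := by simp only [det]; ring
theorem det_swap_right (a b c : Plane) : det a c b = -det a b c := by simp only [det]; ring
theorem det_rotate (a b c : Plane) : det b c a = det a b c := by simp only [det]; ring
theorem det_self_left (a b : Plane) : det a a b = 0 := by simp only [det]; ring
theorem det_self_right (a b : Plane) : det a b b = 0 := by simp only [det]; ring
theorem det_self_outer (a b : Plane) : det a b a = 0 := by simp only [det]; ring

theorem ne_iff_coord {a b : Plane} : a ≠ b ↔ a 0 ≠ b 0 ∨ a 1 ≠ b 1 := by
  rw [← not_and_or, not_iff_not]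
  refine ⟨fun h => by simp [h], fun h => ?_⟩
  ext i
  fin_cases i
  exacts [h.1, h.2]

theorem det_eq_zero_of_line {a b p q r : Plane} (hab : a ≠ b) (hp : det a b p = 0)
    (hq : det a b q = 0) (hr : det a b r = 0) : det p q r = 0 := by
  simp only [det] at *
  rcases ne_iff_coord.1 hab with h | h
  · have h' : b 0 - a 0 ≠ 0 := sub_ne_zero.2 h.symm
    apply mul_left_cancel₀ h'
    linear_combination (q 0 - p 0) * (hr - hp) - (r 0 - p 0) * (hq - hp)
  · have h' : b 1 - a 1 ≠ 0 := sub_ne_zero.2 h.symm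
    apply mul_left_cancel₀ h'
    linear_combination (q 1 - p 1) * (hr - hp) - (r 1 - p 1) * (hq - hp)

/-- All points of `S` lie on a line. -/
def IsCol (S : Finset Plane) : Prop := ∀ a ∈ S, ∀ b ∈ S, ∀ c ∈ S, det a b c = 0

/-- No three points of `S` lie on a line. -/
def GenPos (S : Finset Plane) : Prop :=
  ∀ a ∈ S, ∀ b ∈ S, ∀ c ∈ S, a ≠ b → b ≠ c → a ≠ c → det a b c ≠ 0

/-- The points of `S` are in convex position: in some order, all increasing triples are
counterclockwise. -/
def ConvexPos (S : Finset Plane) : Prop :=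
  ∃ f : Plane → ℕ, Set.InjOn f S ∧
    ∀ a ∈ S, ∀ b ∈ S, ∀ c ∈ S, f a < f b → f b < f c → 0 < det a b c

theorem IsCol.subset {S T : Finset Plane} (h : IsCol S) (hT : T ⊆ S) : IsCol T :=
  fun a ha b hb c hc => h a (hT ha) b (hT hb) c (hT hc)

theorem ConvexPos.subset {S T : Finset Plane} (h : ConvexPos S) (hT : T ⊆ S) : ConvexPos T := by
  obtain ⟨f, h1, h2⟩ := h
  exact ⟨f, h1.mono (by simpa using hT),
    fun a ha b hb c hc => h2 a (hT ha) b (hT hb) c (hT hc)⟩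

theorem SameOrderType.card_eq {X Y : Finset Plane} (h : SameOrderType X Y) : X.card = Y.card := by
  obtain ⟨e, _⟩ := h
  simpa using Fintype.card_congr e

theorem SameOrderType.isCol {X Y : Finset Plane} (h : SameOrderType X Y) (hX : IsCol Y) :
    IsCol X := by
  obtain ⟨e, he⟩ := h
  intro a ha b hb c hc
  rw [← orientation_eq_zero, ← he ⟨a, ha⟩ ⟨b, hb⟩ ⟨c, hc⟩, orientation_eq_zero]
  exact hX _ (e _).2 _ (e _).2 _ (e _).2

theorem SameOrderType.convexPos {X Y : Finset Plane} (h : SameOrderType X Y) (hY : ConvexPos Y) :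
    ConvexPos X := by
  classical
  obtain ⟨e, he⟩ := h
  obtain ⟨f, h1, h2⟩ := hY
  let g : Plane → ℕ := fun a => if ha : a ∈ X then f (e ⟨a, ha⟩) else 0
  have hg : ∀ a (ha : a ∈ X), g a = f (e ⟨a, ha⟩) := fun a ha => dif_pos ha
  refine ⟨g, fun a ha b hb hab => ?_, fun a ha b hb c hc hab hbc => ?_⟩
  · simp only [Finset.mem_coe] at ha hb
    rw [hg a ha, hg b hb] at hab
    have := h1 (e ⟨a, ha⟩).2 (e ⟨b, hb⟩).2 hab
    simpa using e.injective (Subtype.ext this)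
  · rw [hg a ha, hg b hb] at hab
    rw [hg b hb, hg c hc] at hbc
    have := h2 _ (e ⟨a, ha⟩).2 _ (e ⟨b, hb⟩).2 _ (e ⟨c, hc⟩).2 hab hbc
    rw [← sign_eq_one_iff, ← orientation_eq] at this ⊢
    rw [← he ⟨a, ha⟩ ⟨b, hb⟩ ⟨c, hc⟩, this]

theorem sameOrderType_of_isCol {X Y : Finset Plane} (hX : IsCol X) (hY : IsCol Y)
    (h : X.card = Y.card) : SameOrderType X Y := by
  refine ⟨Finset.equivOfCardEq h, fun a b c => ?_⟩
  rw [orientation_eq_zero.2 (hX _ a.2 _ b.2 _ c.2),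
    orientation_eq_zero.2 (hY _ (Subtype.mem _) _ (Subtype.mem _) _ (Subtype.mem _))]

theorem ConvexPos.exists_equiv {X : Finset Plane} (h : ConvexPos X) {m : ℕ} (hm : X.card = m) :
    ∃ e : Fin m ≃ X, ∀ i j l, i < j → j < l → 0 < det (e i) (e j) (e l) := by
  classical
  obtain ⟨f, h1, h2⟩ := h
  have hcard : (X.image f).card = m := by rw [Finset.card_image_of_injOn h1, hm]
  let o := (X.image f).orderIsoOfFin hcard
  let g : X → X.image f := fun a => ⟨f a, Finset.mem_image_of_mem f a.2⟩
  have hg : Function.Bijective g := by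
    refine ⟨fun a b hab => Subtype.ext (h1 a.2 b.2 (congrArg Subtype.val hab)), fun y => ?_⟩
    obtain ⟨a, ha, hy⟩ := Finset.mem_image.1 y.2
    exact ⟨⟨a, ha⟩, Subtype.ext hy⟩
  let E := Equiv.ofBijective g hg
  have hE : ∀ i, f (E.symm (o i)) = o i := fun i => congrArg Subtype.val (E.apply_symm_apply (o i))
  refine ⟨o.toEquiv.trans E.symm, fun i j l hij hjl =>
    h2 _ (Subtype.mem _) _ (Subtype.mem _) _ (Subtype.mem _) ?_ ?_⟩
  · simp only [Equiv.trans_apply, RelIso.coe_fn_toEquiv, hE]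
    exact o.strictMono hij
  · simp only [Equiv.trans_apply, RelIso.coe_fn_toEquiv, hE]
    exact o.strictMono hjl

/-- Matching the two orders makes all increasing triples counterclockwise on both sides. Since `det`
is alternating, this fixes the sign of every other triple. -/
theorem sameOrderType_of_convexPos {X Y : Finset Plane} (hX : ConvexPos X) (hY : ConvexPos Y)
    (h : X.card = Y.card) : SameOrderType X Y := by
  obtain ⟨e, he⟩ := hX.exists_equiv rfl
  obtain ⟨g, hg⟩ := hY.exists_equiv h.symm
  have key : ∀ i j l, SignType.sign (det (g i) (g j) (g l)) =
      SignType.sign (det (e i) (e j) (e l)) := by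
    have base : ∀ i j l, i < j → j < l → SignType.sign (det (g i) (g j) (g l)) =
        SignType.sign (det (e i) (e j) (e l)) := fun i j l h1 h2 => by
      rw [sign_pos (hg i j l h1 h2), sign_pos (he i j l h1 h2)]
    have sw : ∀ i j l, i < j → SignType.sign (det (g i) (g j) (g l)) =
        SignType.sign (det (e i) (e j) (e l)) := by
      intro i j l hij
      rcases lt_trichotomy j l with hjl | rfl | hlj
      · exact base i j l hij hjl
      · rw [det_self_right, det_self_right]
      · rcases lt_trichotomy i l with hil | rfl | hli
        · rw [det_swap_right, det_swap_right (e i : Plane), Left.sign_neg, Left.sign_neg,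
            base i l j hil hlj]
        · rw [det_self_outer, det_self_outer]
        · rw [← det_rotate, ← det_rotate (e i : Plane), ← det_rotate, ← det_rotate (e j : Plane),
            base l i j hli hij]
    intro i j l
    rcases lt_trichotomy i j with hij | rfl | hji
    · exact sw i j l hij
    · rw [det_self_left, det_self_left]
    · rw [det_swap_left, det_swap_left (e j : Plane), Left.sign_neg, Left.sign_neg, sw j i l hji]
  refine ⟨e.symm.trans g, fun a b c => ?_⟩
  have := key (e.symm a) (e.symm b) (e.symm c)
  simpa [orientation_eq] using this

theorem avoids_of_isCol {X S : Finset Plane} (hX : ¬ IsCol X) (hS : IsCol S) : Avoids X S :=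
  fun ⟨_, hY, h⟩ => hX (h.isCol (hS.subset hY))

theorem avoids_of_convexPos {X S : Finset Plane} (hX : ¬ ConvexPos X) (hS : ConvexPos S) :
    Avoids X S :=
  fun ⟨_, hY, h⟩ => hX (h.convexPos (hS.subset hY))

/-- No `m` points of `S` lie on a line. -/
def NoCol (m : ℕ) (S : Finset Plane) : Prop := ∀ Y ⊆ S, Y.card = m → ¬ IsCol Y

theorem avoids_iff_noCol {X S : Finset Plane} (hX : IsCol X) : Avoids X S ↔ NoCol X.card S := by
  constructor
  · intro h Y hY hc hcol
    exact h ⟨Y, hY, sameOrderType_of_isCol hX hcol hc.symm⟩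
  · rintro h ⟨Y, hY, e⟩
    obtain ⟨f, hf⟩ := id e
    refine h Y hY e.card_eq.symm fun a ha b hb c hc => ?_
    have := hf (f.symm ⟨a, ha⟩) (f.symm ⟨b, hb⟩) (f.symm ⟨c, hc⟩)
    simp only [Equiv.apply_symm_apply] at this
    rw [← orientation_eq_zero, this, orientation_eq_zero]
    exact hX _ (Subtype.mem _) _ (Subtype.mem _) _ (Subtype.mem _)

theorem isCol_of_collinear {X : Finset Plane} (h : Collinear ℝ (X : Set Plane)) : IsCol X := by
  rw [collinear_iff_exists_forall_eq_smul_vadd] at h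
  obtain ⟨p, v, h⟩ := h
  intro a ha b hb c hc
  obtain ⟨r, rfl⟩ := h a ha
  obtain ⟨s, rfl⟩ := h b hb
  obtain ⟨t, rfl⟩ := h c hc
  simp only [det, vadd_eq_add, PiLp.add_apply, PiLp.smul_apply, smul_eq_mul]
  ring

theorem isCol_of_card_le_two {Y : Finset Plane} (h : Y.card ≤ 2) : IsCol Y := by
  intro a ha b hb c hc
  by_cases hab : a = b
  · rw [hab, det_self_left]
  by_cases hbc : b = c
  · rw [hbc, det_self_right]
  by_cases hac : a = c
  · rw [hac, det_self_outer]
  exact absurd h (not_le.2 (Finset.two_lt_card.2 ⟨a, ha, b, hb, c, hc, hab, hac, hbc⟩))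

theorem isCol_of_line {a b : Plane} (hab : a ≠ b) {S : Finset Plane}
    (h : ∀ p ∈ S, det a b p = 0) : IsCol S :=
  fun _ hp _ hq _ hr => det_eq_zero_of_line hab (h _ hp) (h _ hq) (h _ hr)

/-- A point of a solution can be exchanged for one of many points on a line through it. -/
theorem NoCol.exchange {m k : ℕ} {S T : Finset Plane} {p q : Plane} (hS : NoCol m S)
    (hk : S.card = k) (hp : p ∈ S) (hqp : q ≠ p) (hT : ∀ t ∈ T, det q p t = 0) (hpT : p ∉ T)
    (hcard : k ^ 2 ≤ T.card) : ∃ t ∈ T, t ∉ S ∧ NoCol m (insert t (S.erase p)) := by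
  classical
  -- These are the points of `T` that could complete a line through `a` and `b`, where `a` is off
  -- the line carrying `T`. Two lines that differ meet in at most one point, so each pair spoils at
  -- most one.
  let bad : Plane × Plane → Finset Plane := fun ab =>
    T.filter fun t => det q p ab.1 ≠ 0 ∧ ab.1 ≠ ab.2 ∧ det ab.1 ab.2 t = 0
  have hbad : ∀ ab, (bad ab).card ≤ 1 := by
    rintro ⟨a, b⟩
    rw [Finset.card_le_one]
    intro t ht t' ht'
    simp only [bad, Finset.mem_filter] at ht ht'
    by_contra hne
    have h1 := det_eq_zero_of_line ht.2.2.1 ht.2.2.2 ht'.2.2.2 (det_self_outer a b)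
    have h2 := det_eq_zero_of_line hqp (hT t ht.1) (hT t' ht'.1) (det_self_outer q p)
    have h3 := det_eq_zero_of_line hqp (hT t ht.1) (hT t' ht'.1) (det_self_right q p)
    exact ht.2.1 (det_eq_zero_of_line hne h2 h3 h1)
  set S' := S.erase p with hS'
  have hS'card : S'.card + 1 = k := by rw [← hk]; exact Finset.card_erase_add_one hp
  set U := S' ∪ (S' ×ˢ S').biUnion bad with hU
  have hUcard : U.card < T.card := by
    calc U.card ≤ S'.card + (S' ×ˢ S').card * 1 :=
          (Finset.card_union_le _ _).trans (Nat.add_le_add_left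
            (Finset.card_biUnion_le_card_mul _ _ _ fun ab _ => hbad ab) _)
      _ = S'.card + S'.card * S'.card := by rw [Finset.card_product, mul_one]
      -- With `k - 1` remaining points, at most `(k - 1) + (k - 1) ^ 2 = k * (k - 1)` points are
      -- excluded.
      _ < k ^ 2 := by rw [← hS'card]; nlinarith
      _ ≤ _ := hcard
  obtain ⟨t, htT, htU⟩ := Finset.exists_mem_notMem_of_card_lt_card hUcard
  have htS' : t ∉ S' := fun h => htU (Finset.mem_union_left _ h)
  have htp : t ≠ p := fun h => hpT (h ▸ htT)
  have htS : t ∉ S := fun h => htS' (Finset.mem_erase.2 ⟨htp, h⟩)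
  refine ⟨t, htT, htS, fun Y hY hYm hYc => ?_⟩
  have hS'S : S' ⊆ S := Finset.erase_subset _ _
  by_cases htY : t ∈ Y
  swap
  · exact hS Y (((Finset.subset_insert_iff_of_notMem htY).1 hY).trans hS'S) hYm hYc
  have hY' : Y.erase t ⊆ S' := by
    rw [← Finset.subset_insert_iff]; exact hY
  have hY'card : (Y.erase t).card + 1 = m := by rw [← hYm]; exact Finset.card_erase_add_one htY
  have hpY' : p ∉ Y.erase t := fun h => by
    have := hY' h
    simp [hS'] at this
  -- If the rest of `Y` lies on the line of `T`, putting `p` back for `t` gives a collinear subset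
  -- of `S`. Otherwise a point `a` is off this line: another point of `Y` beside `a` and `t` would
  -- make `t` bad, and if there is none then `{a, p}` is a collinear pair of size `m` in `S`.
  by_cases hall : ∀ a ∈ Y.erase t, det q p a = 0
  · refine hS (insert p (Y.erase t)) (Finset.insert_subset hp (hY'.trans hS'S)) ?_
      (isCol_of_line hqp ?_)
    · rw [Finset.card_insert_of_notMem hpY', hY'card]
    · intro a ha
      rcases Finset.mem_insert.1 ha with rfl | ha
      · exact det_self_right q a
      · exact hall a ha
  · push Not at hall
    obtain ⟨a, ha, hqa⟩ := hall
    by_cases hb : ∃ b ∈ Y.erase t, a ≠ b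
    · obtain ⟨b, hb, hab⟩ := hb
      refine htU (Finset.mem_union_right _ (Finset.mem_biUnion.2 ⟨(a, b),
        Finset.mem_product.2 ⟨hY' ha, hY' hb⟩, Finset.mem_filter.2 ⟨htT, hqa, hab, ?_⟩⟩))
      exact hYc a (Finset.mem_of_mem_erase ha) b (Finset.mem_of_mem_erase hb) t htY
    · push Not at hb
      have h1 : Y.erase t = {a} := by
        ext b
        rw [Finset.mem_singleton]
        exact ⟨fun h => (hb b h).symm, fun h => h ▸ ha⟩
      have h2 : (insert p (Y.erase t)).card = m := by
        rw [Finset.card_insert_of_notMem hpY', hY'card]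
      refine hS _ (Finset.insert_subset hp (hY'.trans hS'S)) h2 (isCol_of_card_le_two ?_)
      rw [Finset.card_insert_of_notMem hpY', h1]
      simp

/-- `p` is on the line through `a` and `b`, or equal to both. -/
def InSpan (a b p : Plane) : Prop := (a = b ∧ p = a) ∨ (a ≠ b ∧ det a b p = 0)

theorem isCol_of_inSpan {a b : Plane} {S : Finset Plane} (h : ∀ p ∈ S, InSpan a b p) :
    IsCol S := by
  by_cases hab : a = b
  · have : ∀ p ∈ S, p = a := fun p hp => by
      rcases h p hp with h | h
      exacts [h.2, absurd hab h.1]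
    intro p hp q hq r hr
    rw [this p hp, this q hq, det_self_left]
  · refine isCol_of_line hab fun p hp => ?_
    rcases h p hp with h | h
    exacts [absurd h.1 hab, h.2]

/-- Every finite set is covered by the lines spanned by a subset in general position. -/
theorem exists_genPos_span (S : Finset Plane) :
    ∃ Q ⊆ S, GenPos Q ∧ ∀ p ∈ S, ∃ a ∈ Q, ∃ b ∈ Q, InSpan a b p := by
  classical
  have hne : (S.powerset.filter GenPos).Nonempty :=
    ⟨∅, Finset.mem_filter.2 ⟨by simp, fun a ha => by simp at ha⟩⟩
  obtain ⟨Q, hQ, hmax⟩ := Finset.exists_max_image _ Finset.card hne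
  -- By maximality of `Q`, adding a further point `p` creates a collinear triple, and this triple
  -- must consist of `p` and two points of `Q`.
  rw [Finset.mem_filter, Finset.mem_powerset] at hQ
  refine ⟨Q, hQ.1, hQ.2, fun p hp => ?_⟩
  by_cases hpQ : p ∈ Q
  · exact ⟨p, hpQ, p, hpQ, .inl ⟨rfl, rfl⟩⟩
  have hnot : ¬ GenPos (insert p Q) := fun h => by
    have := hmax (insert p Q) (Finset.mem_filter.2
      ⟨Finset.mem_powerset.2 (Finset.insert_subset hp hQ.1), h⟩)
    rw [Finset.card_insert_of_notMem hpQ] at this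
    omega
  by_contra hcon
  have hc : ∀ a ∈ Q, ∀ b ∈ Q, a ≠ b → det a b p ≠ 0 := fun a ha b hb hab h0 =>
    hcon ⟨a, ha, b, hb, .inr ⟨hab, h0⟩⟩
  refine hnot fun a ha b hb c hc' hab hbc hac => ?_
  rcases Finset.mem_insert.1 ha with rfl | ha₁
  · rw [← det_rotate]
    exact hc b ((Finset.mem_insert.1 hb).resolve_left hab.symm) c
      ((Finset.mem_insert.1 hc').resolve_left hac.symm) hbc
  rcases Finset.mem_insert.1 hb with rfl | hb₁
  · rw [det_swap_right]
    exact neg_ne_zero.2 (hc a ha₁ c ((Finset.mem_insert.1 hc').resolve_left hbc.symm) hac)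
  rcases Finset.mem_insert.1 hc' with rfl | hc₁
  · exact hc a ha₁ b hb₁ hab
  · exact hQ.2 a ha₁ b hb₁ c hc₁ hab hbc hac

theorem card_le_of_span {S Q : Finset Plane} {L : ℕ} (hL : 1 ≤ L) (hQS : Q ⊆ S)
    (hQ : ∀ p ∈ S, ∃ a ∈ Q, ∃ b ∈ Q, InSpan a b p)
    (hS : ∀ a ∈ S, ∀ b ∈ S, a ≠ b → ∀ T ⊆ S, (∀ p ∈ T, det a b p = 0) → T.card ≤ L) :
    S.card ≤ Q.card ^ 2 * L := by
  classical
  have hsub : S ⊆ (Q ×ˢ Q).biUnion fun ab => S.filter fun p => InSpan ab.1 ab.2 p := by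
    intro p hp
    obtain ⟨a, ha, b, hb, h⟩ := hQ p hp
    exact Finset.mem_biUnion.2 ⟨(a, b), Finset.mem_product.2 ⟨ha, hb⟩, Finset.mem_filter.2 ⟨hp, h⟩⟩
  refine (Finset.card_le_card hsub).trans ?_
  rw [sq, ← Finset.card_product]
  refine Finset.card_biUnion_le_card_mul _ _ _ fun ab hab => ?_
  rw [Finset.mem_product] at hab
  by_cases h : ab.1 = ab.2
  · refine le_trans (Finset.card_le_one.2 fun p hp p' hp' => ?_) hL
    rw [Finset.mem_filter] at hp hp'
    rcases hp.2 with hp | hp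
    · rcases hp'.2 with hp' | hp'
      · rw [hp.2, hp'.2]
      · exact absurd h hp'.1
    · exact absurd h hp.1
  · refine hS _ (hQS hab.1) _ (hQS hab.2) h _ (Finset.filter_subset _ _) fun p hp => ?_
    rcases (Finset.mem_filter.1 hp).2 with hp | hp
    exacts [absurd hp.1 h, hp.2]

/-! ### The Erdős–Szekeres theorem on points in convex position -/

section chains

variable {α : Type*} [LinearOrder α]

/-- All increasing triples in `C` satisfy `P`. -/
def Homog (P : α → α → α → Prop) (C : Finset α) : Prop :=
  ∀ a ∈ C, ∀ b ∈ C, ∀ c ∈ C, a < b → b < c → P a b c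

theorem Homog.subset {P : α → α → α → Prop} {C D : Finset α} (h : Homog P C) (hD : D ⊆ C) :
    Homog P D := fun a ha b hb c hc => h a (hD ha) b (hD hb) c (hD hc)

open Classical in
/-- The homogeneous subsets of `s` whose last two elements are `i` and `j`. -/
noncomputable def chains (P : α → α → α → Prop) (s : Finset α) (i j : α) : Finset (Finset α) :=
  s.powerset.filter fun C => Homog P C ∧ i ∈ C ∧ j ∈ C ∧ ∀ x ∈ C, x ≠ j → x ≤ i

/-- The largest size of a homogeneous subset of `s` whose last two elements are `i` and `j`. -/
noncomputable def chainLength (P : α → α → α → Prop) (s : Finset α) (i j : α) : ℕ :=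
  (chains P s i j).sup Finset.card

/-- A longest chain ending in `h, i` can be extended by `j`. Transitivity over `h` gives `P a i j`
for every earlier `a`, and transitivity over `i` then gives `P a b j` for all earlier pairs. -/
theorem chainLength_lt {P : α → α → α → Prop} {s : Finset α}
    (hP : ∀ a ∈ s, ∀ b ∈ s, ∀ c ∈ s, ∀ d ∈ s, a < b → b < c → c < d → P a b c → P b c d →
      P a b d ∧ P a c d) {h i j : α} (hh : h ∈ s) (hi : i ∈ s) (hj : j ∈ s)
    (hhi : h < i) (hij : i < j) (hPh : P h i j) :
    chainLength P s h i < chainLength P s i j := by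
  classical
  have hne : (chains P s h i).Nonempty := by
    refine ⟨{h, i}, Finset.mem_filter.2 ⟨?_, ?_, by simp, by simp, ?_⟩⟩
    · rw [Finset.mem_powerset]
      exact Finset.insert_subset hh (Finset.singleton_subset_iff.2 hi)
    · intro a ha b hb c hc hab hbc
      simp only [Finset.mem_insert, Finset.mem_singleton] at ha hb hc
      rcases ha with rfl | rfl <;> rcases hb with rfl | rfl <;> rcases hc with rfl | rfl <;>
        first
        | exact absurd hab (lt_irrefl _)
        | exact absurd hbc (lt_irrefl _)
        | exact absurd (hab.trans hbc) (lt_irrefl _)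
    · intro x hx hxi
      simp only [Finset.mem_insert, Finset.mem_singleton] at hx
      exact (hx.resolve_right hxi).le
  obtain ⟨C, hC, hCsup⟩ := Finset.exists_mem_eq_sup _ hne Finset.card
  rw [chainLength, hCsup]
  obtain ⟨hCs, hhom, hhC, hiC, hlast⟩ := Finset.mem_filter.1 hC
  rw [Finset.mem_powerset] at hCs
  have hle : ∀ x ∈ C, x ≤ i := fun x hx => by
    by_cases hxi : x = i
    · exact hxi.le
    · exact (hlast x hx hxi).trans hhi.le
  have hjC : j ∉ C := fun hjC => absurd (hle j hjC) (not_le.2 hij)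
  have hPi : ∀ a ∈ C, a < i → P a i j := by
    intro a ha hai
    by_cases hah : a = h
    · exact hah ▸ hPh
    · have hlt : a < h := lt_of_le_of_ne (hlast a ha hai.ne) hah
      exact (hP a (hCs ha) h hh i hi j hj hlt hhi hij (hhom a ha h hhC i hiC hlt hhi) hPh).2
  have hins : insert j C ∈ chains P s i j := by
    refine Finset.mem_filter.2 ⟨?_, ?_, Finset.mem_insert_of_mem hiC, Finset.mem_insert_self _ _,
      ?_⟩
    · rw [Finset.mem_powerset]; exact Finset.insert_subset hj hCs
    · intro a ha b hb c hc hab hbc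
      have hbj : b ≠ j := by
        rintro rfl
        rcases Finset.mem_insert.1 hc with rfl | hc₁
        · exact lt_irrefl _ hbc
        · exact absurd (hbc.trans_le (hle c hc₁)) (not_lt.2 hij.le)
      have hb₁ := (Finset.mem_insert.1 hb).resolve_left hbj
      have haj : a ≠ j := by
        rintro rfl
        exact absurd (hab.trans_le (hle b hb₁)) (not_lt.2 hij.le)
      have ha₁ := (Finset.mem_insert.1 ha).resolve_left haj
      rcases Finset.mem_insert.1 hc with rfl | hc₁
      · rcases (hle b hb₁).eq_or_lt with rfl | hbi
        · exact hPi a ha₁ hab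
        · exact (hP a (hCs ha₁) b (hCs hb₁) i hi c hj hab hbi hij
            (hhom a ha₁ b hb₁ i hiC hab hbi) (hPi b hb₁ hbi)).1
      · exact hhom a ha₁ b hb₁ c hc₁ hab hbc
    · intro x hx hxj
      exact hle x ((Finset.mem_insert.1 hx).resolve_left hxj)
  have := Finset.le_sup (f := Finset.card) hins
  rw [Finset.card_insert_of_notMem hjC] at this
  exact this

/-- Attach to `j` the set `A j` of pairs of chain lengths over all `i < j`. If all lengths are below
`k`, there are only `2 ^ (k * k)` such sets, so `A i = A j` for some `i < j`. The pair of `(i, j)`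
then also occurs as the pair of some `(h, i)`, but one of its two entries must grow strictly along
`h, i, j`. -/
theorem exists_homog {P Q : α → α → α → Prop} {s : Finset α} {k : ℕ}
    (hP : ∀ a ∈ s, ∀ b ∈ s, ∀ c ∈ s, ∀ d ∈ s, a < b → b < c → c < d → P a b c → P b c d →
      P a b d ∧ P a c d)
    (hQ : ∀ a ∈ s, ∀ b ∈ s, ∀ c ∈ s, ∀ d ∈ s, a < b → b < c → c < d → Q a b c → Q b c d →
      Q a b d ∧ Q a c d)
    (hPQ : ∀ a ∈ s, ∀ b ∈ s, ∀ c ∈ s, a < b → b < c → P a b c ∨ Q a b c)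
    (hs : 2 ^ (k * k) < s.card) :
    ∃ C ⊆ s, C.card = k ∧ (Homog P C ∨ Homog Q C) := by
  classical
  by_contra hcon
  push Not at hcon
  have hbig : ∀ C ⊆ s, (Homog P C ∨ Homog Q C) → C.card < k := by
    intro C hC hh
    by_contra hk
    obtain ⟨D, hD, hDk⟩ := Finset.exists_subset_card_eq (not_lt.1 hk)
    have := hcon D (hD.trans hC) hDk
    rcases hh with hh | hh
    exacts [this.1 (hh.subset hD), this.2 (hh.subset hD)]
  have hk : 0 < k := by
    have := hbig ∅ (by simp) (.inl fun a ha => by simp at ha)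
    simpa using this
  have hlP : ∀ i j, chainLength P s i j < k := fun i j => by
    rw [chainLength, Finset.sup_lt_iff (by simpa using hk)]
    intro C hC
    obtain ⟨h1, h2, _⟩ := Finset.mem_filter.1 hC
    exact hbig C (Finset.mem_powerset.1 h1) (.inl h2)
  have hlQ : ∀ i j, chainLength Q s i j < k := fun i j => by
    rw [chainLength, Finset.sup_lt_iff (by simpa using hk)]
    intro C hC
    obtain ⟨h1, h2, _⟩ := Finset.mem_filter.1 hC
    exact hbig C (Finset.mem_powerset.1 h1) (.inr h2)
  let A : α → Finset (ℕ × ℕ) := fun j =>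
    (s.filter (· < j)).image fun i => (chainLength P s i j, chainLength Q s i j)
  have hA : ∀ j ∈ s, A j ∈ (Finset.range k ×ˢ Finset.range k).powerset := by
    intro j _
    rw [Finset.mem_powerset]
    intro x hx
    obtain ⟨i, _, rfl⟩ := Finset.mem_image.1 hx
    simp [hlP, hlQ]
  have hcard : ((Finset.range k ×ˢ Finset.range k).powerset).card < s.card := by
    simpa [Finset.card_powerset] using hs
  have main : ∀ i ∈ s, ∀ j ∈ s, i < j → A i ≠ A j := by
    intro i hi j hj hij hAij
    have hm : (chainLength P s i j, chainLength Q s i j) ∈ A j :=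
      Finset.mem_image.2 ⟨i, Finset.mem_filter.2 ⟨hi, hij⟩, rfl⟩
    rw [← hAij] at hm
    obtain ⟨h, hh, heq⟩ := Finset.mem_image.1 hm
    obtain ⟨hh, hhi⟩ := Finset.mem_filter.1 hh
    rw [Prod.mk.injEq] at heq
    rcases hPQ h hh i hi j hj hhi hij with h' | h'
    · exact (chainLength_lt hP hh hi hj hhi hij h').ne heq.1
    · exact (chainLength_lt hQ hh hi hj hhi hij h').ne heq.2
  obtain ⟨i, hi, j, hj, hne, heq⟩ := Finset.exists_ne_map_eq_of_card_lt_of_maps_to hcard hA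
  rcases lt_or_gt_of_ne hne with h | h
  · exact main i hi j hj h heq
  · exact main j hj i hi h heq.symm

end chains

/-- Counting the smaller points of `S` turns an arbitrary linear order into the natural number
labels that `ConvexPos` requires. -/
theorem convexPos_of_order {α : Type*} [LinearOrder α] {S : Finset Plane} (φ : Plane → α)
    (hφ : Function.Injective φ)
    (h : ∀ a ∈ S, ∀ b ∈ S, ∀ c ∈ S, φ a < φ b → φ b < φ c → 0 < det a b c) : ConvexPos S := by
  classical
  let g : Plane → ℕ := fun p => (S.filter fun q => φ q < φ p).card
  have hg : ∀ a ∈ S, ∀ b, φ a < φ b → g a < g b := by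
    intro a ha b hab
    refine Finset.card_lt_card (Finset.ssubset_iff_of_subset ?_ |>.2 ⟨a, ?_, ?_⟩)
    · intro q hq
      rw [Finset.mem_filter] at hq ⊢
      exact ⟨hq.1, hq.2.trans hab⟩
    · exact Finset.mem_filter.2 ⟨ha, hab⟩
    · simp
  have hg' : ∀ a ∈ S, ∀ b ∈ S, g a < g b → φ a < φ b := by
    intro a _ b hb hab
    by_contra hc
    rcases (not_lt.1 hc).eq_or_lt with h | h
    · rw [hφ h] at hab; exact lt_irrefl _ hab
    · exact lt_asymm hab (hg b hb a h)
  refine ⟨g, fun a ha b hb hab => ?_, fun a ha b hb c hc hab hbc =>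
    h a ha b hb c hc (hg' a ha b hb hab) (hg' b hb c hc hbc)⟩
  rcases lt_trichotomy (φ a) (φ b) with h | h | h
  · exact absurd hab (hg a ha b h).ne
  · exact hφ h
  · exact absurd hab (hg b hb a h).ne'

/-- The lexicographic order of the plane. -/
noncomputable def lexKey (p : Plane) : ℝ ×ₗ ℝ := toLex (p 0, p 1)

theorem lexKey_injective : Function.Injective lexKey := by
  intro a b h
  by_contra hne
  have h' : (a 0, a 1) = (b 0, b 1) := toLex.injective h
  rw [Prod.mk.injEq] at h'
  rcases ne_iff_coord.1 hne with h1 | h1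
  exacts [h1 h'.1, h1 h'.2]

theorem lexKey_lt {a b : Plane} : lexKey a < lexKey b ↔ a 0 < b 0 ∨ a 0 = b 0 ∧ a 1 < b 1 :=
  Prod.Lex.toLex_lt_toLex

/-- Let `u`, `v`, `w` be the successive differences, all in the closed right half-plane. For `v 0 >
0`, positivity of `u × w` follows from `(u × w) * v 0 = (u × v) * w 0 + (v × w) * u 0`. Both
conclusions add this product to a given determinant. Lexicographic order admits vertical segments.
-/
theorem det_pos_trans {a b c d : Plane} (hab : lexKey a < lexKey b) (hbc : lexKey b < lexKey c)
    (hcd : lexKey c < lexKey d) (h1 : 0 < det a b c) (h2 : 0 < det b c d) :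
    0 < det a b d ∧ 0 < det a c d := by
  rw [lexKey_lt] at hab hbc hcd
  have hcross : 0 < (b 0 - a 0) * (d 1 - c 1) - (b 1 - a 1) * (d 0 - c 0) := by
    simp only [det] at h1 h2
    have e1 : 0 < (b 0 - a 0) * (c 1 - b 1) - (b 1 - a 1) * (c 0 - b 0) := by linarith
    have e2 : 0 < (c 0 - b 0) * (d 1 - c 1) - (c 1 - b 1) * (d 0 - c 0) := by linarith
    have u0 : 0 ≤ b 0 - a 0 := by rcases hab with h | h <;> linarith [h]
    have w0 : 0 ≤ d 0 - c 0 := by rcases hcd with h | h <;> linarith [h]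
    rcases hbc with hv | ⟨hv, hv1⟩
    · have v0 : 0 < c 0 - b 0 := by linarith
      rcases hab with hu | ⟨hu, hu1⟩
      · have u0' : 0 < b 0 - a 0 := by linarith
        by_contra hcon
        have := mul_nonneg w0 e1.le
        have := mul_pos u0' e2
        nlinarith
      · rw [show b 0 - a 0 = 0 by linarith] at e1
        nlinarith
    · rw [show c 0 - b 0 = 0 by linarith] at e2
      nlinarith
  constructor
  · simp only [det] at *; linarith
  · simp only [det] at *; linarith

theorem det_neg_trans {a b c d : Plane} (hab : lexKey a < lexKey b) (hbc : lexKey b < lexKey c)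
    (hcd : lexKey c < lexKey d) (h1 : det a b c < 0) (h2 : det b c d < 0) :
    det a b d < 0 ∧ det a c d < 0 := by
  rw [lexKey_lt] at hab hbc hcd
  have hcross : (b 0 - a 0) * (d 1 - c 1) - (b 1 - a 1) * (d 0 - c 0) < 0 := by
    simp only [det] at h1 h2
    have e1 : (b 0 - a 0) * (c 1 - b 1) - (b 1 - a 1) * (c 0 - b 0) < 0 := by linarith
    have e2 : (c 0 - b 0) * (d 1 - c 1) - (c 1 - b 1) * (d 0 - c 0) < 0 := by linarith
    have u0 : 0 ≤ b 0 - a 0 := by rcases hab with h | h <;> linarith [h]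
    rcases hbc with hv | ⟨hv, hv1⟩
    · have v0 : 0 < c 0 - b 0 := by linarith
      rcases hcd with hw | ⟨hw, hw1⟩
      · have w0 : 0 < d 0 - c 0 := by linarith
        by_contra hcon
        have := mul_nonneg u0 (neg_pos.2 e2).le
        have := mul_pos w0 (neg_pos.2 e1)
        nlinarith
      · rw [show d 0 - c 0 = 0 by linarith] at e2
        nlinarith
    · rw [show c 0 - b 0 = 0 by linarith] at e1
      nlinarith
  constructor
  · simp only [det] at *; linarith
  · simp only [det] at *; linarith

theorem exists_convexPos {S : Finset Plane} {k : ℕ} (hS : GenPos S) (hk : 2 ^ (k * k) < S.card) :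
    ∃ C ⊆ S, C.card = k ∧ ConvexPos C := by
  let : LinearOrder Plane := LinearOrder.lift' lexKey lexKey_injective
  obtain ⟨C, hC, hCk, h⟩ := exists_homog (P := fun a b c => 0 < det a b c)
    (Q := fun a b c => det a b c < 0) (s := S)
    (fun a _ b _ c _ d _ h1 h2 h3 h4 h5 => det_pos_trans h1 h2 h3 h4 h5)
    (fun a _ b _ c _ d _ h1 h2 h3 h4 h5 => det_neg_trans h1 h2 h3 h4 h5)
    (fun a ha b hb c hc h1 h2 =>
      (lt_or_gt_of_ne (hS a ha b hb c hc h1.ne h2.ne (h1.trans h2).ne)).symm) hk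
  refine ⟨C, hC, hCk, ?_⟩
  rcases h with h | h
  · exact convexPos_of_order (fun p => p) (fun _ _ h => h) h
  -- A chain of clockwise triples becomes counterclockwise when traversed backwards.
  · refine convexPos_of_order (fun p => OrderDual.toDual p) (fun _ _ h => h) ?_
    intro a ha b hb c hc hab hbc
    have : det c b a < 0 := h c hc b hb a ha hbc hab
    rw [← det_rotate, det_swap_right] at this
    rw [← det_rotate]
    linarith

end PointPatterns

namespace PointPatterns

/-! ### Orientation answers and ranks of candidates -/

theorem orientationCode_injective : Function.Injective orientationCode := by decide

theorem orientationCode_le (s : SignType) : orientationCode s ≤ 2 := by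
  cases s <;> simp [orientationCode]

theorem orientationOracle_le {n : ℕ} (pts : Fin n ↪ Plane) (a b c : ℕ) :
    orientationOracle pts a b c ≤ 2 := by
  rw [orientationOracle]
  split_ifs
  exacts [orientationCode_le _, by omega]

theorem orientationOracle_val {n : ℕ} (pts : Fin n ↪ Plane) (a b c : Fin n) :
    orientationOracle pts a b c = orientationCode (orientation (pts a) (pts b) (pts c)) := by
  rw [orientationOracle, dif_pos ⟨a.2, b.2, c.2⟩]

theorem orientationOracle_eq_zero {n : ℕ} (pts : Fin n ↪ Plane) (a b c : Fin n) :
    orientationOracle pts a b c = 0 ↔ det (pts a) (pts b) (pts c) = 0 := by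
  rw [orientationOracle_val, ← orientation_eq_zero]
  exact orientationCode_injective.eq_iff' rfl

open Classical in
/-- The number of elements of `u` below `p`. -/
noncomputable def rank (u : ℕ → Prop) (p : ℕ) : ℕ := ((Finset.range p).filter u).card

theorem rank_lt_rank {u : ℕ → Prop} {p q : ℕ} (hp : u p) (h : p < q) : rank u p < rank u q := by
  classical
  refine Finset.card_lt_card ((Finset.ssubset_iff_of_subset fun x hx => ?_).2 ⟨p, ?_, ?_⟩)
  · simp only [Finset.mem_filter, Finset.mem_range] at hx ⊢
    exact ⟨hx.1.trans h, hx.2⟩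
  · simp [hp, h]
  · simp

theorem rank_injOn (u : ℕ → Prop) : Set.InjOn (rank u) {p | u p} := by
  intro p hp q hq h
  rcases lt_trichotomy p q with h' | h' | h'
  exacts [absurd h (rank_lt_rank hp h').ne, h', absurd h (rank_lt_rank hq h').ne']

open Classical in
/-- The first `N` of the indices that satisfy `u`. -/
noncomputable def selected {n : ℕ} (u : ℕ → Prop) (N : ℕ) : Finset (Fin n) :=
  Finset.univ.filter fun p => u p ∧ rank u p < N

/-! ### Bit masks of candidates and the test for a solution -/

namespace Expr

variable {χ : ℕ → ℕ → ℕ → ℕ}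

/-- `v / 2 ^ i`; the variables `7` and `8` are auxiliary. -/
def shiftE (v i : Expr) : Expr :=
  .desc 7 i v (countE 8 (.var 7) (ltE (.add (.var 8) (.var 8)) (.var 7)))

/-- The bit of `v` with index `i`. -/
def bitE (v i : Expr) : Expr :=
  .sub (shiftE v i) (.add (shiftE v (.add i (.const 1))) (shiftE v (.add i (.const 1))))

theorem card_filter_double (a : ℕ) :
    ((Finset.range a).filter fun z => z + z < a).card = a - a / 2 := by
  have : (Finset.range a).filter (fun z => z + z < a) = Finset.range (a - a / 2) := by
    ext z
    simp only [Finset.mem_filter, Finset.mem_range]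
    omega
  rw [this, Finset.card_range]

/-- There are `a - a / 2` numbers `z < a` with `2 * z < a`; subtracting their number halves `a`, and
`i` repetitions divide by `2 ^ i`. -/
theorem eval_shiftE (v i : Expr) (R : Memory) :
    eval χ (shiftE v i) R = eval χ v R / 2 ^ eval χ i R := by
  have hf : (fun acc => acc - eval χ (countE 8 (.var 7) (ltE (.add (.var 8) (.var 8)) (.var 7)))
      (Function.update R 7 acc)) = fun acc => acc / 2 := by
    funext acc
    rw [eval_countE]
    simp only [ltE_ne_zero, eval, Function.update_self,
      Function.update_of_ne (show (7 : ℕ) ≠ 8 by decide)]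
    rw [card_filter_double]
    omega
  rw [shiftE, eval, hf]
  generalize eval χ i R = n
  induction n with
  | zero => simp
  | succ n ih => rw [Function.iterate_succ_apply', ih, pow_succ, Nat.div_div_eq_div_mul]

theorem bitE_ne_zero (v i : Expr) (R : Memory) :
    eval χ (bitE v i) R ≠ 0 ↔ (eval χ v R).testBit (eval χ i R) = true := by
  simp only [bitE, eval, eval_shiftE]
  rw [Nat.testBit_eq_decide_div_mod_eq, decide_eq_true_iff, pow_succ, ← Nat.div_div_eq_div_mul]
  omega

theorem below_bitE {V : ℕ} {v i : Expr} (hV : 8 < V) (hv : Below V v) (hi : Below V i) :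
    Below V (bitE v i) := by
  simp only [bitE, shiftE, Below, below_countE, below_ltE]
  simp only [hv, hi, and_true, true_and]
  omega

/-- The number of `y` below `p` with `U y`. -/
def rankE (U : ℕ → Expr) (p : ℕ) : Expr := countE 6 (.var p) (U 6)

/-- `p` is one of the first `b` elements of `U`. -/
def firstE (U : ℕ → Expr) (b : Expr) (p : ℕ) : Expr := andE (U p) (ltE (rankE U p) b)

/-- `p` is one of the first `R[2]` elements of `U`, and the bit of `R[4]` at its rank is set. -/
def memE (U : ℕ → Expr) (p : ℕ) : Expr :=
  andE (firstE U (.var 2) p) (bitE (.var 4) (rankE U p))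

/-- The variables starting at `b` form a copy of the pattern with the orientations `code`. -/
def copyE {m : ℕ} (U : ℕ → Expr) (b : ℕ) (code : Fin m → Fin m → Fin m → ℕ) : Expr :=
  allE ((List.finRange m).map fun i : Fin m => andE (memE U (b + i)) (allE ((List.finRange m).map fun j : Fin m =>
    andE (orE (.const (if i = j then 1 else 0)) (notE (eqE (.var (b + i)) (.var (b + j)))))
      (allE ((List.finRange m).map fun l : Fin m =>
        eqE (.query (.var (b + i)) (.var (b + j)) (.var (b + l))) (.const (code i j l)))))))

/-- The set encoded by `R[4]` has `R[1]` elements and contains no copy of the pattern. -/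
def solutionE {m : ℕ} (U : ℕ → Expr) (b : ℕ) (code : Fin m → Fin m → Fin m → ℕ) : Expr :=
  andE (eqE (countE 13 (.var 0) (memE U 13)) (.var 1))
    (notE (exList ((List.finRange m).map fun i : Fin m => (b + (i : ℕ), .var 0)) (copyE U b code)))

end Expr

open PointPatterns.Expr

variable {χ : ℕ → ℕ → ℕ → ℕ} {r m : ℕ}

/-- The candidate predicate `u` with arguments taken from the memory. -/
def atMemory (u : (ℕ → ℕ → ℕ → ℕ) → ℕ → ℕ → (Fin r → ℕ) → ℕ → Prop) (χ : ℕ → ℕ → ℕ → ℕ)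
    (R : Memory) : ℕ → Prop :=
  u χ (R 0) (R 1) fun i => R (14 + i)

/-- The expression `U` expresses the candidate predicate `u`. -/
def Expresses (U : ℕ → Expr) (u : (ℕ → ℕ → ℕ → ℕ) → ℕ → ℕ → (Fin r → ℕ) → ℕ → Prop) : Prop :=
  -- Registers `9` to `11` are reserved for variables bound inside candidate expressions, and `12`
  -- for the success flag.
  (∀ χ x R, x ≤ 8 ∨ 12 < x → (eval χ (U x) R ≠ 0 ↔ atMemory u χ R (R x))) ∧
    ∀ x V, 14 + r ≤ V → x < V → Below V (U x)

variable {U : ℕ → Expr} {u : (ℕ → ℕ → ℕ → ℕ) → ℕ → ℕ → (Fin r → ℕ) → ℕ → Prop}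

theorem atMemory_update {x i : ℕ} (hx : 2 ≤ x) (hx' : x < 14 ∨ 14 + r ≤ x) (R : Memory) :
    atMemory u χ (Function.update R x i) = atMemory u χ R := by
  unfold atMemory
  rw [Function.update_of_ne (by omega), Function.update_of_ne (by omega)]
  congr 1
  funext j
  rw [Function.update_of_ne (by omega)]

theorem Expresses.eval_rankE (h : Expresses U u) {p : ℕ} (R : Memory) :
    eval χ (rankE U p) R = rank (atMemory u χ R) (R p) := by
  classical
  rw [rankE, eval_countE, rank]
  congr 1
  refine Finset.filter_congr fun i _ => ?_
  rw [h.1 _ _ _ (.inl (by omega)), atMemory_update (by omega) (by omega), Function.update_self]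

theorem Expresses.below_rankE (h : Expresses U u) {p V : ℕ} (hV : 14 + r ≤ V) (hp : p < V) :
    Below V (rankE U p) := by
  rw [rankE, below_countE]
  exact ⟨by omega, hp, h.2 _ _ hV (by omega)⟩

theorem Expresses.firstE_ne_zero (h : Expresses U u) {p : ℕ} (hp : p ≤ 8 ∨ 12 < p) (b : Expr)
    (R : Memory) : eval χ (firstE U b p) R ≠ 0 ↔
      atMemory u χ R (R p) ∧ rank (atMemory u χ R) (R p) < eval χ b R := by
  rw [firstE, andE_ne_zero, ltE_ne_zero, h.1 _ _ _ hp, h.eval_rankE]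

theorem Expresses.below_firstE (h : Expresses U u) {p V : ℕ} {b : Expr} (hV : 14 + r ≤ V)
    (hp : p < V) (hb : Below V b) : Below V (firstE U b p) := by
  rw [firstE, below_andE, below_ltE]
  exact ⟨h.2 _ _ hV hp, h.below_rankE hV hp, hb⟩

/-- The meaning of `memE`. -/
def Mem (u : ℕ → Prop) (N v p : ℕ) : Prop := (u p ∧ rank u p < N) ∧ v.testBit (rank u p) = true

theorem Expresses.memE_ne_zero (h : Expresses U u) {p : ℕ} (hp : p ≤ 8 ∨ 12 < p)
    (R : Memory) : eval χ (memE U p) R ≠ 0 ↔ Mem (atMemory u χ R) (R 2) (R 4) (R p) := by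
  rw [memE, andE_ne_zero, h.firstE_ne_zero hp, bitE_ne_zero, h.eval_rankE]
  rfl

theorem Expresses.below_memE (h : Expresses U u) {p V : ℕ} (hV : 14 + r ≤ V)
    (hp : p < V) : Below V (memE U p) := by
  rw [memE, below_andE]
  exact ⟨h.below_firstE hV hp (by simp only [Below]; omega),
    below_bitE (by omega) (by simp only [Below]; omega) (h.below_rankE hV hp)⟩

theorem Expresses.below_solutionE (h : Expresses U u) {V : ℕ}
    (code : Fin m → Fin m → Fin m → ℕ) (hV : 14 + r + m ≤ V) :
    Below V (solutionE U (14 + r) code) := by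
  have hv : ∀ i : Fin m, 14 + r + (i : ℕ) < V := fun i => by omega
  simp only [solutionE, below_andE, below_eqE, below_countE, below_notE, below_exList, copyE,
    below_allE, List.mem_map, List.mem_finRange, true_and, forall_exists_index, below_orE,
    forall_apply_eq_imp_iff, Below]
  exact ⟨⟨⟨by omega, by omega, h.below_memE (by omega) (by omega)⟩, by omega⟩,
    fun i => ⟨hv i, by omega⟩, fun i => ⟨h.below_memE (by omega) (hv i), fun j =>
      ⟨⟨hv i, hv j⟩, fun l => ⟨⟨hv i, hv j, hv l⟩, trivial⟩⟩⟩⟩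

theorem Expresses.copyE_ne_zero (h : Expresses U u) {b : ℕ} (hb : 12 < b)
    (code : Fin m → Fin m → Fin m → ℕ) (R : Memory) :
    eval χ (copyE U b code) R ≠ 0 ↔ (∀ i : Fin m, Mem (atMemory u χ R) (R 2) (R 4) (R (b + i))) ∧
      (∀ i j : Fin m, R (b + i) = R (b + j) → i = j) ∧
      ∀ i j l : Fin m, χ (R (b + i)) (R (b + j)) (R (b + l)) = code i j l := by
  simp only [copyE, allE_ne_zero, List.mem_map, List.mem_finRange, true_and, forall_exists_index,
    forall_apply_eq_imp_iff, andE_ne_zero, orE_ne_zero, notE_ne_zero, eqE_ne_zero]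
  have hm : ∀ i : Fin m, eval χ (memE U (b + i)) R ≠ 0 ↔
      Mem (atMemory u χ R) (R 2) (R 4) (R (b + i)) := fun i => h.memE_ne_zero (.inr (by omega)) R
  simp only [hm, eval]
  constructor
  · intro H
    refine ⟨fun i => (H i).1, fun i j hij => ?_, fun i j l => ((H i).2 j).2 l⟩
    rcases ((H i).2 j).1 with h' | h'
    · by_contra hc; simp [hc] at h'
    · exact absurd hij h'
  · rintro ⟨h1, h2, h3⟩ i
    refine ⟨h1 i, fun j => ⟨?_, fun l => h3 i j l⟩⟩
    by_cases hij : i = j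
    · simp [hij]
    · exact .inr fun hc => hij (h2 i j hc)

open Classical in
theorem Expresses.solutionE_ne_zero (h : Expresses U u)
    (code : Fin m → Fin m → Fin m → ℕ) (R : Memory) :
    eval χ (solutionE U (14 + r) code) R ≠ 0 ↔
      ((Finset.range (R 0)).filter (Mem (atMemory u χ R) (R 2) (R 4))).card = R 1 ∧
      ¬ ∃ g : Fin m → ℕ, (∀ i, g i < R 0 ∧ Mem (atMemory u χ R) (R 2) (R 4) (g i)) ∧
        Function.Injective g ∧ ∀ i j l, χ (g i) (g j) (g l) = code i j l := by
  have hcount : eval χ (countE 13 (.var 0) (memE U 13)) R =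
      ((Finset.range (R 0)).filter (Mem (atMemory u χ R) (R 2) (R 4))).card := by
    rw [eval_countE]
    congr 1
    refine Finset.filter_congr fun i _ => ?_
    rw [h.memE_ne_zero (.inr (by omega)), atMemory_update (by omega) (by omega),
      Function.update_self, Function.update_of_ne (by omega), Function.update_of_ne (by omega)]
  rw [solutionE, andE_ne_zero, eqE_ne_zero, hcount, notE_ne_zero,
    exList_ne_zero (m := 1)]
  · simp only [eval]
    refine and_congr_right fun _ => not_congr ⟨?_, ?_⟩
    · rintro ⟨R', h1, h2, h3⟩
      have hlow : ∀ j < 14 + r, R' j = R j := fun j hj => h1 j (by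
        simp only [List.mem_map, List.mem_finRange, true_and, forall_exists_index,
          forall_apply_eq_imp_iff]
        omega)
      have hmem : atMemory u χ R' = atMemory u χ R := by
        unfold atMemory
        rw [hlow 0 (by omega), hlow 1 (by omega)]
        congr 1
        funext i
        exact hlow _ (by omega)
      rw [h.copyE_ne_zero (by omega), hmem, hlow 2 (by omega), hlow 4 (by omega)] at h3
      refine ⟨fun i => R' (14 + r + i), fun i => ⟨?_, h3.1 i⟩, fun i j hij => h3.2.1 i j hij,
        h3.2.2⟩
      exact h2 (14 + r + (i : ℕ), .var 0) (List.mem_map.2 ⟨i, List.mem_finRange i, rfl⟩)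
    · rintro ⟨g, h1, h2, h3⟩
      let R' : Memory := fun j => if hj : 14 + r ≤ j ∧ j < 14 + r + m then
        g ⟨j - (14 + r), by omega⟩ else R j
      have hlow : ∀ j, ¬ (14 + r ≤ j ∧ j < 14 + r + m) → R' j = R j := fun j hj => dif_neg hj
      have hR' : ∀ i : Fin m, R' (14 + r + i) = g i := fun i => by
        simp only [R']
        rw [dif_pos ⟨by omega, by omega⟩]
        congr 1
        ext
        simp
      have hmem : atMemory u χ R' = atMemory u χ R := by
        unfold atMemory
        rw [hlow 0 (by omega), hlow 1 (by omega)]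
        congr 1
        funext i
        exact hlow _ (by omega)
      refine ⟨R', fun j hj => hlow j fun hj' => ?_, ?_, ?_⟩
      · exact hj (j, .var 0) (List.mem_map.2 ⟨⟨j - (14 + r), by omega⟩, List.mem_finRange _, by
          simp only [Prod.mk.injEq, and_true]; omega⟩) rfl
      · simp only [List.mem_map, List.mem_finRange, true_and, forall_exists_index,
          forall_apply_eq_imp_iff, hR']
        exact fun i => (h1 i).1
      · rw [h.copyE_ne_zero (by omega), hmem, hlow 2 (by omega), hlow 4 (by omega)]
        simp only [hR']
        exact ⟨fun i => (h1 i).2, fun i j hij => h2 hij, h3⟩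
  · rw [List.map_map]
    refine (List.nodup_finRange m).map fun i j hij => ?_
    simp only [Function.comp] at hij
    ext
    omega
  · simp only [List.mem_map, List.mem_finRange, true_and, forall_exists_index,
      forall_apply_eq_imp_iff, Below]
    omega

/-- Codes of the orientations of the triples of an enumerated pattern. -/
noncomputable def patternCode {X : Finset Plane} (e : Fin m ≃ X) (i j l : Fin m) : ℕ :=
  orientationCode (orientation (e i) (e j) (e l))

/-- Once `X` is enumerated, its orientations form a fixed finite table that can be built into the
program; a copy is an injective tuple of indices answering queries according to it. -/
theorem not_avoids_iff {n : ℕ} (pts : Fin n ↪ Plane) {X : Finset Plane} (e : Fin m ≃ X)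
    (I : Finset (Fin n)) : ¬ Avoids X (I.map pts) ↔
      ∃ g : Fin m → Fin n, (∀ i, g i ∈ I) ∧ Function.Injective g ∧
        ∀ i j l, orientationOracle pts (g i) (g j) (g l) = patternCode e i j l := by
  classical
  rw [Avoids, not_not]
  constructor
  · rintro ⟨Y, hY, f, hf⟩
    have hx : ∀ i, ∃ a ∈ I, pts a = f (e i) := fun i => by
      simpa using hY (f (e i)).2
    choose g hg1 hg2 using hx
    refine ⟨g, hg1, fun i j hij => ?_, fun i j l => ?_⟩
    · have : (f (e i) : Plane) = f (e j) := by rw [← hg2, ← hg2, hij]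
      simpa using Subtype.ext this
    · rw [orientationOracle_val, hg2, hg2, hg2, hf, patternCode]
  · rintro ⟨g, hg1, hg2, hg3⟩
    let G : Fin m ↪ Plane := ⟨fun i => pts (g i), fun i j hij => hg2 (pts.injective hij)⟩
    refine ⟨Finset.univ.map G, ?_, ?_⟩
    · intro p hp
      obtain ⟨i, _, rfl⟩ := Finset.mem_map.1 hp
      exact Finset.mem_map_of_mem pts (hg1 i)
    · let F : Fin m → (Finset.univ.map G : Finset Plane) := fun i =>
        ⟨G i, Finset.mem_map_of_mem G (Finset.mem_univ i)⟩
      have hF : Function.Bijective F := by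
        refine ⟨fun i j hij => G.injective (congrArg Subtype.val hij), fun y => ?_⟩
        obtain ⟨i, _, hi⟩ := Finset.mem_map.1 y.2
        exact ⟨i, Subtype.ext hi⟩
      refine ⟨e.symm.trans (Equiv.ofBijective F hF), fun a b c => ?_⟩
      have := hg3 (e.symm a) (e.symm b) (e.symm c)
      rw [orientationOracle_val, patternCode, Equiv.apply_symm_apply, Equiv.apply_symm_apply,
        Equiv.apply_symm_apply] at this
      exact orientationCode_injective this

open Classical in
theorem Expresses.solutionE_iff (h : Expresses U u) {n : ℕ} (pts : Fin n ↪ Plane)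
    {X : Finset Plane} (e : Fin m ≃ X) (R : Memory) (hR : R 0 = n) :
    eval (orientationOracle pts) (solutionE U (14 + r) (patternCode e)) R ≠ 0 ↔
      ((Finset.univ.filter fun p : Fin n =>
        Mem (atMemory u (orientationOracle pts) R) (R 2) (R 4) p).card = R 1 ∧
      Avoids X ((Finset.univ.filter fun p : Fin n =>
        Mem (atMemory u (orientationOracle pts) R) (R 2) (R 4) p).map pts)) := by
  rw [h.solutionE_ne_zero, hR]
  refine and_congr ?_ ?_
  · rw [← Finset.card_map Fin.valEmbedding (s := Finset.univ.filter _)]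
    have : (Finset.univ.filter fun p : Fin n => Mem (atMemory u (orientationOracle pts) R) (R 2)
        (R 4) p).map Fin.valEmbedding = (Finset.range n).filter
          (Mem (atMemory u (orientationOracle pts) R) (R 2) (R 4)) := by
      ext p
      simp only [Finset.mem_map, Finset.mem_filter, Finset.mem_univ, true_and, Finset.mem_range,
        Fin.valEmbedding_apply]
      exact ⟨fun ⟨a, h1, h2⟩ => h2 ▸ ⟨a.2, h1⟩, fun ⟨h1, h2⟩ => ⟨⟨p, h1⟩, h2, rfl⟩⟩
    rw [this]
  · rw [← not_iff_not, not_not, not_avoids_iff pts e]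
    constructor
    · rintro ⟨g, h1, h2, h3⟩
      refine ⟨fun i => ⟨g i, (h1 i).1⟩, fun i => ?_, fun i j hij => h2 ?_, h3⟩
      · simpa using (h1 i).2
      · exact congrArg Fin.val hij
    · rintro ⟨g, h1, h2, h3⟩
      refine ⟨fun i => g i, fun i => ⟨(g i).2, ?_⟩, fun i j hij => h2 (Fin.ext hij), h3⟩
      simpa using h1 i

-- The mask is the sum of `2 ^ rank u p` over `p ∈ J`. Ranks are injective on candidates, so no two
-- points share a bit, and those of selected points are below `N`.
open Classical in
theorem exists_bits {n N : ℕ} {u : ℕ → Prop} {J : Finset (Fin n)} (hJ : J ⊆ selected u N) :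
    ∃ v < 2 ^ N, (Finset.univ.filter fun p : Fin n => Mem u N v p) = J := by
  let A := J.image fun p : Fin n => rank u p
  have hsel : ∀ p ∈ J, u p ∧ rank u p < N := fun p hp => by
    simpa [selected] using hJ hp
  refine ⟨∑ i ∈ A, 2 ^ i, Nat.geomSum_lt le_rfl ?_, ?_⟩
  · intro i hi
    obtain ⟨p, hp, rfl⟩ := Finset.mem_image.1 hi
    exact (hsel p hp).2
  · ext p
    rw [Finset.mem_filter, Mem]
    simp only [Finset.mem_univ, true_and]
    rw [← Nat.mem_bitIndices, ← List.mem_toFinset, Finset.toFinset_bitIndices_sum_two_pow]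
    constructor
    · rintro ⟨⟨h1, h2⟩, h3⟩
      obtain ⟨q, hq, hqp⟩ := Finset.mem_image.1 h3
      have := rank_injOn u (hsel q hq).1 h1 hqp
      rwa [← Fin.ext this]
    · exact fun hp => ⟨hsel p hp, Finset.mem_image_of_mem _ hp⟩

theorem listsIndices_of_eq {n : ℕ} {R : Memory} {I : Finset (Fin n)} {s : ℕ → Prop}
    [DecidablePred s] (hI : ∀ p : Fin n, p ∈ I ↔ s p)
    (h : (((List.range (R 0)).map fun j => R (R 1 + j) : List ℕ) : Multiset ℕ) =
      (Multiset.range n).filter s) : ListsIndices R I := by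
  rw [ListsIndices, h]
  have : (I.map Fin.valEmbedding) = (Finset.range n).filter s := by
    ext p
    simp only [Finset.mem_map, Finset.mem_filter, Finset.mem_range, Fin.valEmbedding_apply]
    exact ⟨fun ⟨a, h1, h2⟩ => h2 ▸ ⟨a.2, (hI a).1 h1⟩, fun ⟨h1, h2⟩ => ⟨⟨p, h1⟩, (hI _).2 h2, rfl⟩⟩
  exact (congrArg Finset.val this).symm

/-! ### Exhaustive search over masks and index tuples -/

namespace Expr

/-- `D * (k * k + k + 1)` for `k` in register `1`. -/
def exponentE (D : ℕ) : Expr :=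
  .sum 5 (.const D) (.add (.add (.sum 6 (.var 1) (.var 1)) (.var 1)) (.const 1))

theorem eval_exponentE (χ : ℕ → ℕ → ℕ → ℕ) (D : ℕ) (R : Memory) :
    eval χ (exponentE D) R = D * (R 1 * R 1 + R 1 + 1) := by
  simp [exponentE, eval]

/-- The variables to be searched for, with their bounds. -/
def searchVars (r : ℕ) : List (ℕ × Expr) :=
  -- The bound is `n + 1` rather than `n` so that index variables have a possible value even when `n
  -- = 0`.
  (4, .var 3) :: (List.finRange r).map fun i : Fin r => (14 + (i : ℕ), .add (.var 0) (.const 1))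

theorem mem_searchVars {r : ℕ} {xb : ℕ × Expr} : xb ∈ searchVars r ↔
    xb = (4, .var 3) ∨ ∃ i : Fin r, (14 + (i : ℕ), .add (.var 0) (.const 1)) = xb := by
  simp [searchVars]

end Expr

/-- Computing `N` and `2 ^ N`, searching for a solution, and listing it. -/
def solveProgram {m : ℕ} (r D : ℕ) (U : ℕ → Expr) (code : Fin m → Fin m → Fin m → ℕ) : Program :=
  .seq (assignPow (14 + r + m + 1) 2 (exponentE D)) (.seq (assignPow (14 + r + m + 1) 3 (.var 2))
    (.seq (search (14 + r + m) (searchVars r) (solutionE U (14 + r) code))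
      (.seq (assign (14 + r + m + 1) 12 (notE (notE (solutionE U (14 + r) code))))
        (output (14 + r + m + 1) 13 (memE U 13)))))

variable {r : ℕ}

theorem hasSubset_map_iff {n : ℕ} (pts : Fin n ↪ Plane) {prop : Finset Plane → Prop}
    {I : Finset (Fin n)} {k : ℕ} :
    HasSubset prop (I.map pts) k ↔ ∃ J ⊆ I, J.card = k ∧ prop (J.map pts) := by
  constructor
  · rintro ⟨S, hS, hk, hp⟩
    obtain ⟨J, hJ, rfl⟩ := Finset.subset_map_iff.1 hS
    exact ⟨J, hJ, by rwa [Finset.card_map] at hk, hp⟩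
  · rintro ⟨J, hJ, hk, hp⟩
    exact ⟨_, Finset.map_subset_map.2 hJ, by rwa [Finset.card_map], hp⟩

theorem computable_bound (D a : ℕ) : Computable fun k : ℕ =>
    5 * (2 ^ 2 ^ (D * (k * k + k + 1)) + 2 ^ (D * (k * k + k + 1)) + k + 2) ^ a := by
  have hpow : Primrec₂ fun x y : ℕ => x ^ y := Primrec₂.unpaired'.1 Nat.Primrec.pow
  have hE : Primrec fun k : ℕ => D * (k * k + k + 1) :=
    Primrec.nat_mul.comp (Primrec.const D) (Primrec.nat_add.comp (Primrec.nat_add.comp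
      (Primrec.nat_mul.comp Primrec.id Primrec.id) Primrec.id) (Primrec.const 1))
  have hN : Primrec fun k : ℕ => 2 ^ (D * (k * k + k + 1)) := hpow.comp (Primrec.const 2) hE
  have hW : Primrec fun k : ℕ => 2 ^ 2 ^ (D * (k * k + k + 1)) := hpow.comp (Primrec.const 2) hN
  exact (Primrec.nat_mul.comp (Primrec.const 5) (hpow.comp (Primrec.nat_add.comp
    (Primrec.nat_add.comp (Primrec.nat_add.comp hW hN) Primrec.id) (Primrec.const 2))
    (Primrec.const a))).to_comp

/-- This reduces tractability to choosing candidates such that, for a suitable `q`, the first `N`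
still contain a solution. Soundness needs no hypothesis on them, because the found set is tested
directly. -/
theorem subsetFPT_of_candidates (X : Finset Plane) (D : ℕ) {U : ℕ → Expr}
    {u : (ℕ → ℕ → ℕ → ℕ) → ℕ → ℕ → (Fin r → ℕ) → ℕ → Prop} (hU : Expresses U u)
    (H : ∀ (n : ℕ) (pts : Fin n ↪ Plane) (k N : ℕ), 2 ^ (D * (k * k + k + 1)) = N →
      HasSubset (Avoids X) (Finset.univ.map pts) k → ∃ q : Fin r → ℕ, (∀ i, q i ≤ n) ∧
        HasSubset (Avoids X) ((selected (u (orientationOracle pts) n k q) N).map pts) k) :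
    SubsetFPT (Avoids X) := by
  classical
  obtain ⟨m, ⟨e⟩⟩ : ∃ m, Nonempty (Fin m ≃ X) := ⟨X.card, ⟨X.equivFin.symm⟩⟩
  set V := 14 + r + m with hV
  set φ := solutionE U (14 + r) (patternCode e) with hφ
  have hφV : Below V φ := hU.below_solutionE _ le_rfl
  obtain ⟨a₁, h₁⟩ := run_assignPow (V := V + 1) (x := 2) (e := exponentE D)
    (by simp only [exponentE, Below, true_and, and_true]; omega) (by omega)
  obtain ⟨a₂, h₂⟩ := run_assignPow (V := V + 1) (x := 3) (e := .var 2)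
    (by simp only [Below]; omega) (by omega)
  obtain ⟨a₃, h₃⟩ := run_search (V := V) (m := 4) (searchVars r) φ hφV (by omega) (by
    intro xb hxb
    rcases mem_searchVars.1 hxb with rfl | ⟨i, rfl⟩
    · simp only [Below]; omega
    · simp only [Below, and_true]; omega)
  obtain ⟨a₄, h₄⟩ := run_assign (V := V + 1) (x := 12) (e := notE (notE φ))
    (by simpa using hφV.mono (Nat.le_succ V)) (by omega)
  obtain ⟨a₅, h₅⟩ := run_output (V := V + 1) (x := 13) (e := memE U 13)
    (hU.below_memE (by omega) (by omega)) (by omega) (by omega)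
  set a := a₁ + a₂ + a₃ + a₄ + a₅ with ha
  refine ⟨solveProgram r D U (patternCode e), _, a, computable_bound D a, fun n pts k => ?_⟩
  set N := 2 ^ (D * (k * k + k + 1)) with hN
  set W := 2 ^ N with hW
  set χ := orientationOracle pts with hχdef
  have hχ : ∀ i j l, χ i j l ≤ 2 := orientationOracle_le pts
  clear_value N W
  -- `B` bounds every register occurring as input, including `2 ^ N`. As a product, its powers split
  -- into a power of `n + 1` and a computable function of `k`.
  set B := (n + 1) * (W + N + k + 2) with hB
  have hBle : ∀ x, x ≤ n + 1 ∨ x ≤ W + N + k + 2 → x ≤ B := by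
    rintro x (h | h)
    · exact h.trans (Nat.le_mul_of_pos_right _ (by omega))
    · exact h.trans (Nat.le_mul_of_pos_left _ (by omega))
  have hB2 : 2 ≤ B := hBle 2 (by omega)
  clear_value B
  suffices hrun : Run χ (solveProgram r D U (patternCode e)) (initialMemory n k)
      (B ^ a₁ + (B ^ a₂ + (B ^ a₃ + (B ^ a₄ + B ^ a₅)))) fun R =>
        (R 2 = 1 ∧ ∃ I : Finset (Fin n), ListsIndices R I ∧ I.card = k ∧ Avoids X (I.map pts)) ∨
        (R 2 = 0 ∧ ¬ HasSubset (Avoids X) (Finset.univ.map pts) k) by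
    obtain ⟨t, R, hR, ht, hQ⟩ := hrun
    refine ⟨t, R, hR, ht.trans ?_, hQ⟩
    have p : ∀ b ≤ a, B ^ b ≤ B ^ a := fun b hb => Nat.pow_le_pow_right (by omega) hb
    have p1 := p a₁ (by omega)
    have p2 := p a₂ (by omega)
    have p3 := p a₃ (by omega)
    have p4 := p a₄ (by omega)
    have p5 := p a₅ (by omega)
    calc _ ≤ 5 * B ^ a := by omega
      _ = _ := by rw [hB, mul_pow, hW, hN]; ring
  have hR0 : ∀ j, initialMemory n k j ≤ B := fun j => by
    rw [initialMemory]
    split_ifs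
    exacts [hBle _ (by omega), hBle _ (by omega), by omega]
  refine Run.seq ((h₁ χ hχ _ B hB2 fun j _ => hR0 j).mono le_rfl fun R₁ g₁ => ?_)
  rw [eval_exponentE] at g₁
  simp only [show initialMemory n k 1 = k from rfl, ← hN] at g₁
  have hR1 : ∀ j < V + 1, R₁ j ≤ B := fun j hj => by
    rw [g₁ j hj]
    by_cases h : j = 2
    · rw [h, Function.update_self]; exact hBle _ (by omega)
    · rw [Function.update_of_ne h]; exact hR0 j
  refine Run.seq ((h₂ χ hχ _ B hB2 hR1).mono le_rfl fun R₂ g₂ => ?_)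
  simp only [eval, g₁ 2 (by omega), Function.update_self, ← hW] at g₂
  have hR2 : ∀ j < V + 1, R₂ j ≤ B := fun j hj => by
    rw [g₂ j hj]
    by_cases h : j = 3
    · rw [h, Function.update_self]; exact hBle _ (by omega)
    · rw [Function.update_of_ne h]; exact hR1 j hj
  have b0 : R₂ 0 = n := by
    rw [g₂ 0 (by omega), Function.update_of_ne (by omega), g₁ 0 (by omega),
      Function.update_of_ne (by omega)]; rfl
  have b1 : R₂ 1 = k := by
    rw [g₂ 1 (by omega), Function.update_of_ne (by omega), g₁ 1 (by omega),
      Function.update_of_ne (by omega)]; rfl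
  have b2 : R₂ 2 = N := by
    rw [g₂ 2 (by omega), Function.update_of_ne (by omega), g₁ 2 (by omega),
      Function.update_self]
  have b3 : R₂ 3 = W := by rw [g₂ 3 (by omega), Function.update_self]
  refine Run.seq ((h₃ χ hχ R₂ B hB2 hR2 ?_).mono le_rfl fun R₃ g₃ => ?_)
  · intro xb hxb
    rcases mem_searchVars.1 hxb with rfl | ⟨i, rfl⟩
    · simp only [eval, b3]; exact hBle _ (by omega)
    · simp only [eval, b0]; exact hBle _ (by omega)
  obtain ⟨hR3, hsame, hfound⟩ := g₃
  have hsame' : ∀ j < 4, R₃ j = R₂ j := fun j hj => hsame j (by omega) fun xb hxb => by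
    rcases mem_searchVars.1 hxb with rfl | ⟨i, rfl⟩
    · simp only; omega
    · simp only; omega
  have c0 : R₃ 0 = n := (hsame' 0 (by omega)).trans b0
  have c1 : R₃ 1 = k := (hsame' 1 (by omega)).trans b1
  have c2 : R₃ 2 = N := (hsame' 2 (by omega)).trans b2
  refine Run.seq ((h₄ χ hχ R₃ B hB2 hR3).mono le_rfl fun R₄ g₄ => ?_)
  have hflag : eval χ (notE (notE φ)) R₃ ≤ 1 := eval_notE_le _ _
  have hR4 : ∀ j < V + 1, R₄ j ≤ B := fun j hj => by
    rw [g₄ j hj]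
    by_cases h : j = 12
    · rw [h, Function.update_self]; omega
    · rw [Function.update_of_ne h]; exact hR3 j hj
  refine (h₅ χ hχ R₄ B (fun R => eval_andE_le _ _ _) hB2 hR4).mono le_rfl fun R' g₅ => ?_
  obtain ⟨hR'2, hlist⟩ := g₅
  rw [g₄ 12 (by omega), Function.update_self] at hR'2
  have hat : atMemory u χ R₄ = atMemory u χ R₃ := by
    unfold atMemory
    rw [g₄ 0 (by omega), g₄ 1 (by omega), Function.update_of_ne (by omega),
      Function.update_of_ne (by omega)]
    congr 1
    funext i
    rw [g₄ _ (by omega), Function.update_of_ne (by omega)]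
  by_cases hsol : eval χ φ R₃ ≠ 0
  · left
    have hone : eval χ (notE (notE φ)) R₃ ≠ 0 := by simpa using hsol
    have hsol' := (hU.solutionE_iff pts e R₃ c0).1 hsol
    refine ⟨by omega, _, listsIndices_of_eq
      (s := fun i => eval χ (memE U 13) (Function.update R₄ 13 i) ≠ 0) ?_ ?_,
      hsol'.1.trans c1, hsol'.2⟩
    · intro p
      rw [hU.memE_ne_zero (.inr (by omega)), atMemory_update (by omega) (by omega), hat,
        Function.update_self, Function.update_of_ne (by omega), Function.update_of_ne (by omega),
        g₄ 2 (by omega), g₄ 4 (by omega), Function.update_of_ne (by omega),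
        Function.update_of_ne (by omega)]
      simp [hχdef]
    · rw [hlist, g₄ 0 (by omega), Function.update_of_ne (by omega), c0]
  · right
    refine ⟨?_, fun hsub => hsol (hfound ?_)⟩
    · by_contra hc
      rw [hR'2] at hc
      exact hsol (by simpa using hc)
    · obtain ⟨q, hq, hsub⟩ := H n pts k N hN.symm hsub
      obtain ⟨J, hJ, hJk, hJX⟩ := (hasSubset_map_iff pts).1 hsub
      obtain ⟨v, hv, hvJ⟩ := exists_bits hJ
      let R'' : Memory := fun j => if j = 4 then v else
        if hj : 14 ≤ j ∧ j < 14 + r then q ⟨j - 14, by omega⟩ else R₂ j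
      have d4 : R'' 4 = v := if_pos rfl
      have dq : ∀ i : Fin r, R'' (14 + i) = q i := fun i => by
        simp only [R'']
        rw [if_neg (by omega), dif_pos ⟨by omega, by omega⟩]
        congr 1
        ext
        simp
      have dlow : ∀ j < 4, R'' j = R₂ j := fun j hj => by
        simp only [R'']
        rw [if_neg (by omega), dif_neg (by omega)]
      rw [exList_ne_zero (m := 4)]
      · refine ⟨R'', fun j hj => ?_, fun xb hxb => ?_, ?_⟩
        · have h4 : j ≠ 4 := hj (4, .var 3) (mem_searchVars.2 (.inl rfl))
          simp only [R'']
          rw [if_neg h4, dif_neg]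
          intro hc
          exact hj (14 + (j - 14), .add (.var 0) (.const 1))
            (mem_searchVars.2 (.inr ⟨⟨j - 14, by omega⟩, rfl⟩)) (by simp only; omega)
        · rcases mem_searchVars.1 hxb with rfl | ⟨i, rfl⟩
          · simpa only [eval, d4, b3, hW] using hv
          · simp only [eval, dq, b0]
            have := hq i
            omega
        · rw [hU.solutionE_iff pts e R'' ((dlow 0 (by omega)).trans b0)]
          have hu : atMemory u (orientationOracle pts) R'' = u (orientationOracle pts) n k q := by
            unfold atMemory
            rw [dlow 0 (by omega), dlow 1 (by omega), b0, b1]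
            congr 1
            funext i
            exact dq i
          rw [hu, d4, dlow 2 (by omega), b2, dlow 1 (by omega), b1, hvJ]
          exact ⟨hJk, hJX⟩
      · rw [searchVars, List.map_cons, List.map_map, List.nodup_cons]
        refine ⟨?_, (List.nodup_finRange r).map fun i j hij => ?_⟩
        · simp only [List.mem_map, List.mem_finRange, true_and, Function.comp, not_exists]
          intro i
          omega
        · simp only [Function.comp] at hij
          ext
          omega
      · intro xb hxb
        rcases mem_searchVars.1 hxb with rfl | ⟨i, rfl⟩
        · simp only [Below]; omega
        · simp only [Below, and_true]; omega

/-! ### Truncated candidate lists and the kernel program -/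

theorem card_selected_le {n : ℕ} (u : ℕ → Prop) (N : ℕ) :
    (selected u N : Finset (Fin n)).card ≤ N := by
  classical
  rw [← Finset.card_range N]
  refine Finset.card_le_card_of_injOn (fun p => rank u p) (fun p hp => ?_) fun p hp q hq h => ?_
  · simpa [selected] using (Finset.mem_filter.1 hp).2.2
  · exact Fin.ext (rank_injOn u (Finset.mem_filter.1 hp).2.1 (Finset.mem_filter.1 hq).2.1 h)

/-- The dichotomy behind all cases: truncation loses no candidate, or exactly `N` candidates are
available for a counting argument. Ranks increase by at most one at each index, so a rank of at
least `N` means that all smaller ones occur. -/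
theorem subset_selected_or_card_eq {n : ℕ} (u : ℕ → Prop) (N : ℕ) :
    (∀ p : Fin n, u p → p ∈ (selected u N : Finset (Fin n))) ∨
      (selected u N : Finset (Fin n)).card = N := by
  classical
  by_cases h : ∀ p : Fin n, u p → p ∈ (selected u N : Finset (Fin n))
  · exact .inl h
  right
  push Not at h
  obtain ⟨p, hp, hpN⟩ := h
  have hrank : N ≤ rank u p := by
    by_contra hc
    exact hpN (Finset.mem_filter.2 ⟨Finset.mem_univ _, hp, by omega⟩)
  refine le_antisymm (card_selected_le u N) ?_
  have himage : Finset.range N ⊆ (selected u N : Finset (Fin n)).image fun q : Fin n => rank u q := by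
    have key : ∀ x ≤ n, ∀ i < rank u x, ∃ y < x, u y ∧ rank u y = i := by
      intro x
      induction x with
      | zero => intro _ i hi; simp [rank] at hi
      | succ x ih =>
        intro hx i hi
        by_cases hix : i < rank u x
        · obtain ⟨y, hy, h⟩ := ih (by omega) i hix
          exact ⟨y, by omega, h⟩
        · have hsucc : rank u (x + 1) = rank u x + if u x then 1 else 0 := by
            rw [rank, rank, Finset.range_add_one, Finset.filter_insert]
            split_ifs with hux
            · rw [Finset.card_insert_of_notMem (by simp)]
            · rfl
          split_ifs at hsucc with hux
          · exact ⟨x, by omega, hux, by omega⟩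
          · omega
    intro i hi
    rw [Finset.mem_range] at hi
    obtain ⟨y, hy, huy, hyi⟩ := key p p.2.le i (by omega)
    exact Finset.mem_image.2 ⟨⟨y, by omega⟩, Finset.mem_filter.2 ⟨Finset.mem_univ _, huy, by
      simp only; omega⟩, hyi⟩
  have := Finset.card_le_card himage
  rw [Finset.card_range] at this
  exact this.trans Finset.card_image_le

/-- Replacing `k` by the minimum of `k` and `n`, and listing the first `b` candidates. -/
def kernelProgram (U : ℕ → Expr) (b : Expr) : Program :=
  -- Truncated subtraction gives `k - (k - n) = min k n`. With register `2` cleared, all registers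
  -- used are at most `n + 2`, so the running time does not depend on `k`.
  .seq (.sub 2 1 0) (.seq (.sub 1 1 2) (.seq (.const 2 0) (output 14 13 (firstE U b 13))))

theorem subsetKernel_of_candidates {prop : Finset Plane → Prop} {U : ℕ → Expr}
    {u : (ℕ → ℕ → ℕ → ℕ) → ℕ → ℕ → (Fin 0 → ℕ) → ℕ → Prop} (hU : Expresses U u) {b : Expr}
    {size : ℕ → ℕ} (hb : Below 14 b) (hsize : ∀ χ R, eval χ b R = size (R 1))
    (hmono : Monotone size)
    (H : ∀ (n : ℕ) (pts : Fin n ↪ Plane) (k : ℕ),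
      HasSubset prop (Finset.univ.map pts) k → HasSubset prop
        ((selected (u (orientationOracle pts) n (min k n) Fin.elim0) (size (min k n))).map pts) k) :
    SubsetKernel prop size := by
  classical
  obtain ⟨a, h⟩ := run_output (V := 14) (x := 13) (e := firstE U b 13)
    (hU.below_firstE (by omega) (by omega) hb) (by omega) (by omega)
  refine ⟨kernelProgram U b, 3 + 2 ^ a, a, fun n pts k => ?_⟩
  set χ := orientationOracle pts with hχdef
  have hχ : ∀ i j l, χ i j l ≤ 2 := orientationOracle_le pts
  suffices hrun : Run χ (kernelProgram U b) (initialMemory n k)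
      (1 + (1 + (1 + (n + 2) ^ a))) fun R => ∃ I : Finset (Fin n), ListsIndices R I ∧
        I.card ≤ size k ∧
        (HasSubset prop (I.map pts) k ↔ HasSubset prop (Finset.univ.map pts) k) by
    obtain ⟨t, R, hR, ht, hQ⟩ := hrun
    refine ⟨t, R, hR, ht.trans ?_, hQ⟩
    have h1 : (n + 2) ^ a ≤ (2 * (n + 1)) ^ a := Nat.pow_le_pow_left (by omega) a
    have h2 : 1 ≤ (n + 1) ^ a := Nat.one_le_pow _ _ (by omega)
    rw [mul_pow] at h1
    rw [add_mul]
    omega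
  refine Run.seq (Run.sub (Run.seq (Run.sub (Run.seq (Run.const ?_)))))
  set R₀ := Function.update (Function.update (Function.update (initialMemory n k) 2
    (initialMemory n k 1 - initialMemory n k 0)) 1 (Function.update (initialMemory n k) 2
    (initialMemory n k 1 - initialMemory n k 0) 1 - Function.update (initialMemory n k) 2
    (initialMemory n k 1 - initialMemory n k 0) 2)) 2 0 with hR₀
  have i0 : R₀ 0 = n := by simp [hR₀, Function.update, initialMemory]
  have i1 : R₀ 1 = min k n := by
    simp only [hR₀, Function.update, initialMemory]
    simp
    omega
  have iB : ∀ j < 14, R₀ j ≤ n + 2 := by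
    intro j _
    rcases Nat.lt_or_ge j 2 with hj | hj
    · interval_cases j
      · omega
      · rw [i1]; omega
    · have : R₀ j = 0 := by
        simp only [hR₀, Function.update, initialMemory]
        by_cases hj2 : j = 2
        · simp [hj2]
        · simp [hj2, show j ≠ 0 by omega, show j ≠ 1 by omega]
      omega
  refine (h χ hχ R₀ (n + 2) (fun R => eval_andE_le _ _ _) (by omega) iB).mono le_rfl
    fun R' ⟨_, hlist⟩ => ?_
  have hu : atMemory u χ R₀ = u χ n (min k n) Fin.elim0 := by
    unfold atMemory
    rw [i0, i1]
    congr 1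
    funext i
    exact i.elim0
  refine ⟨selected (u χ n (min k n) Fin.elim0) (size (min k n)), listsIndices_of_eq
    (s := fun i => eval χ (firstE U b 13) (Function.update R₀ 13 i) ≠ 0) ?_ ?_, ?_, ?_⟩
  · intro p
    rw [hU.firstE_ne_zero (.inr (by omega)), atMemory_update (by omega) (by omega), hsize,
      Function.update_self, Function.update_of_ne (by omega), i1, hu]
    simp [selected]
  · rw [hlist, i0]
  · exact (card_selected_le _ _).trans (hmono (min_le_left k n))
  · refine ⟨fun ⟨S, hS, h⟩ => ⟨S, hS.trans ?_, h⟩, H n pts k⟩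
    exact Finset.map_subset_map.2 (Finset.subset_univ _)

/-! ### Collinear patterns -/

/-- `p` is not preceded by `k * k` points on a line through `p` and another point. -/
def Uncrowded (χ : ℕ → ℕ → ℕ → ℕ) (n k : ℕ) (_ : Fin 0 → ℕ) (p : ℕ) : Prop :=
  ¬ ∃ q < n, q ≠ p ∧ k * k ≤ ((Finset.range p).filter fun s => χ q p s = 0).card

def uncrowdedE (x : ℕ) : Expr :=
  notE (exE 9 (.var 0) (andE (notE (eqE (.var 9) (.var x))) (leE (.sum 11 (.var 1) (.var 1))
    (countE 10 (.var x) (eqE (.query (.var 9) (.var x) (.var 10)) (.const 0))))))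

theorem expresses_uncrowded : Expresses uncrowdedE Uncrowded := by
  refine ⟨fun χ x R hx => ?_, fun x V hV hx => ?_⟩
  · have h9 : x ≠ 9 := by omega
    have h10 : x ≠ 10 := by omega
    have h11 : x ≠ 11 := by omega
    simp only [uncrowdedE, notE_ne_zero, exE_ne_zero, andE_ne_zero, leE_ne_zero, eqE_ne_zero,
      eval_countE]
    simp [eval, h9, h10, atMemory, Uncrowded]
  · simp only [uncrowdedE, below_notE, below_exE, below_andE, below_leE, below_eqE, below_countE,
      Below]
    simp only [and_true]
    omega

theorem card_filter_range {n : ℕ} (p : Fin n) (s : ℕ → Prop) [DecidablePred s] :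
    ((Finset.range p).filter s).card =
      (Finset.univ.filter fun t : Fin n => t < p ∧ s t).card := by
  rw [← Finset.card_map Fin.valEmbedding (s := Finset.univ.filter _)]
  congr 1
  ext t
  simp only [Finset.mem_map, Finset.mem_filter, Finset.mem_univ, true_and, Finset.mem_range,
    Fin.valEmbedding_apply]
  exact ⟨fun ⟨h1, h2⟩ => ⟨⟨t, h1.trans p.2⟩, ⟨h1, h2⟩, rfl⟩, fun ⟨a, h1, h2⟩ => h2 ▸ h1⟩

/-- There is a solution all of whose points are uncrowded. -/
theorem exists_uncrowded_solution {n k m : ℕ} (pts : Fin n ↪ Plane)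
    (h : ∃ J : Finset (Fin n), J.card = k ∧ NoCol m (J.map pts)) (q₀ : Fin 0 → ℕ) :
    ∃ J : Finset (Fin n), J.card = k ∧ NoCol m (J.map pts) ∧
      ∀ p ∈ J, Uncrowded (orientationOracle pts) n k q₀ p := by
  classical
  have hne : ((Finset.univ : Finset (Finset (Fin n))).filter
      fun J => J.card = k ∧ NoCol m (J.map pts)).Nonempty := by
    obtain ⟨J, hJ⟩ := h
    exact ⟨J, Finset.mem_filter.2 ⟨Finset.mem_univ _, hJ⟩⟩
  -- Exchanging a crowded point for an earlier one would lower the sum of indices, so a minimizer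
  -- has no crowded point.
  obtain ⟨J, hJ, hmin⟩ := Finset.exists_min_image _ (fun J : Finset (Fin n) => ∑ p ∈ J, (p : ℕ)) hne
  obtain ⟨hJk, hJm⟩ := (Finset.mem_filter.1 hJ).2
  refine ⟨J, hJk, hJm, fun p hp => ?_⟩
  rintro ⟨q, hq, hqp, hcard⟩
  rw [card_filter_range] at hcard
  set T : Finset (Fin n) := Finset.univ.filter fun t => t < p ∧ orientationOracle pts q p t = 0
    with hT
  have hTmem : ∀ t ∈ T, t < p ∧ det (pts ⟨q, hq⟩) (pts p) (pts t) = 0 := fun t ht => by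
    have := (Finset.mem_filter.1 ht).2
    exact ⟨this.1, (orientationOracle_eq_zero pts ⟨q, hq⟩ p t).1 this.2⟩
  obtain ⟨x, hxT, hxJ, hx⟩ := hJm.exchange (k := k) (T := T.map pts) (p := pts p)
    (q := pts ⟨q, hq⟩) (by rw [Finset.card_map, hJk]) (Finset.mem_map_of_mem pts hp)
    (fun hc => hqp (congrArg Fin.val (pts.injective hc)))
    (fun t ht => by
      obtain ⟨t, htT, rfl⟩ := Finset.mem_map.1 ht
      exact (hTmem t htT).2)
    (fun hc => by
      obtain ⟨t, ht, htp⟩ := Finset.mem_map.1 hc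
      rw [pts.injective htp] at ht
      exact lt_irrefl _ (hTmem p ht).1)
    (by rw [Finset.card_map, sq]; exact hcard)
  obtain ⟨t, ht, rfl⟩ := Finset.mem_map.1 hxT
  have htJ : t ∉ J := fun h => hxJ (Finset.mem_map_of_mem pts h)
  have htJ' : t ∉ J.erase p := fun h => htJ (Finset.mem_of_mem_erase h)
  rw [← Finset.map_erase, ← Finset.map_insert] at hx
  have hle := hmin (insert t (J.erase p)) (Finset.mem_filter.2 ⟨Finset.mem_univ _, by
    rw [Finset.card_insert_of_notMem htJ', Finset.card_erase_add_one hp, hJk], hx⟩)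
  rw [Finset.sum_insert htJ', ← Finset.add_sum_erase J _ hp] at hle
  have : (t : ℕ) < p := (hTmem t ht).1
  omega

theorem GenPos.subset {S T : Finset Plane} (h : GenPos S) (hT : T ⊆ S) : GenPos T :=
  fun a ha b hb c hc => h a (hT ha) b (hT hb) c (hT hc)

theorem GenPos.noCol {Q : Finset Plane} (h : GenPos Q) {m : ℕ} (hm : 3 ≤ m) : NoCol m Q := by
  intro Y hY hYm hcol
  obtain ⟨a, ha, b, hb, c, hc, hab, hac, hbc⟩ := Finset.two_lt_card.1 (show 2 < Y.card by omega)
  exact h a (hY ha) b (hY hb) c (hY hc) hab hbc hac (hcol a ha b hb c hc)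

/-- If truncation loses candidates, the selected points number at least `k ^ 4` with at most `k ^ 2`
on a line. Their spanning set in general position then has at least `k` points, and `k` of these
form a solution. -/
theorem hasSubset_selected_uncrowded {X : Finset Plane} (hX : IsCol X) {n : ℕ}
    (pts : Fin n ↪ Plane) {k N : ℕ} (hN : k ^ 4 ≤ N) (q₀ : Fin 0 → ℕ)
    (h : HasSubset (Avoids X) (Finset.univ.map pts) k) : HasSubset (Avoids X)
      ((selected (Uncrowded (orientationOracle pts) n k q₀) N).map pts) k := by
  classical
  obtain ⟨J₀, _, hJ₀k, hJ₀⟩ := (hasSubset_map_iff pts).1 h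
  rw [avoids_iff_noCol hX] at hJ₀
  obtain ⟨J, hJk, hJm, hJu⟩ := exists_uncrowded_solution pts ⟨J₀, hJ₀k, hJ₀⟩ q₀
  set I : Finset (Fin n) := selected (Uncrowded (orientationOracle pts) n k q₀) N with hI
  rcases subset_selected_or_card_eq (n := n) (Uncrowded (orientationOracle pts) n k q₀) N
    with hall | hcard
  · exact (hasSubset_map_iff pts).2
      ⟨J, fun p hp => hall p (hJu p hp), hJk, (avoids_iff_noCol hX).2 hJm⟩
  rcases Nat.eq_zero_or_pos k with rfl | hk
  · refine ⟨∅, by simp, rfl, (avoids_iff_noCol hX).2 ?_⟩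
    rwa [Finset.card_eq_zero.1 hJk, Finset.map_empty] at hJm
  have hk2 : 1 ≤ k ^ 2 := Nat.one_le_pow _ _ hk
  obtain ⟨Q, hQ, hQgp, hspan⟩ := exists_genPos_span (I.map pts)
  have hle := card_le_of_span (L := k ^ 2) hk2 hQ hspan (by
    intro a _ b _ hab T hT hline
    obtain ⟨T, hTI, rfl⟩ := Finset.subset_map_iff.1 hT
    rw [Finset.card_map]
    by_contra hlt
    rw [not_le] at hlt
    -- Of more than `k ^ 2` selected points on a line, the one with the largest index is preceded by
    -- at least `k ^ 2` others on it, hence crowded.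
    obtain ⟨p, hp, hmax⟩ := T.exists_max_image id (Finset.card_pos.1 (by omega))
    obtain ⟨q, hq, hqp⟩ := Finset.exists_mem_ne (show 1 < T.card by omega) p
    have hcol := isCol_of_line hab hline
    have hun : Uncrowded (orientationOracle pts) n k q₀ p := (Finset.mem_filter.1 (hTI hp)).2.1
    refine hun ⟨q, q.2, fun hc => hqp (Fin.ext hc), ?_⟩
    rw [card_filter_range]
    calc k * k ≤ (T.erase p).card := by rw [Finset.card_erase_of_mem hp, ← sq]; omega
      _ ≤ _ := Finset.card_le_card fun t ht => by
        obtain ⟨htp, htT⟩ := Finset.mem_erase.1 ht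
        refine Finset.mem_filter.2 ⟨Finset.mem_univ _, lt_of_le_of_ne (hmax t htT) htp,
          (orientationOracle_eq_zero pts q p t).2 ?_⟩
        exact hcol _ (Finset.mem_map_of_mem pts hq) _ (Finset.mem_map_of_mem pts hp) _
          (Finset.mem_map_of_mem pts htT))
  rw [Finset.card_map, hcard] at hle
  have hkQ : k ≤ Q.card := by
    by_contra hc
    have h1 : Q.card ^ 2 < k ^ 2 := Nat.pow_lt_pow_left (by omega) (by omega)
    have h2 : Q.card ^ 2 * k ^ 2 < k ^ 2 * k ^ 2 := Nat.mul_lt_mul_of_pos_right h1 (by omega)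
    have h3 : k ^ 2 * k ^ 2 = k ^ 4 := by ring
    omega
  obtain ⟨Q', hQ', hQ'k⟩ := Finset.exists_subset_card_eq hkQ
  refine ⟨Q', hQ'.trans hQ, hQ'k, (avoids_iff_noCol hX).2 ?_⟩
  -- General position says nothing about patterns of at most two points. There the existence of a
  -- solution forces `k < X.card`, so every `k`-point set avoids `X`.
  rcases Nat.lt_or_ge X.card 3 with hm | hm
  · have hkm : k < X.card := by
      by_contra hc
      obtain ⟨Y, hY, hYc⟩ := Finset.exists_subset_card_eq
        (show X.card ≤ (J.map pts).card by rw [Finset.card_map]; omega)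
      exact hJm Y hY hYc (isCol_of_card_le_two (by omega))
    intro Y hY hYc
    have := Finset.card_le_card hY
    omega
  · exact (hQgp.subset hQ').noCol hm

theorem subsetFPT_of_isCol {X : Finset Plane} (hX : IsCol X) : SubsetFPT (Avoids X) := by
  refine subsetFPT_of_candidates X 4 expresses_uncrowded fun n pts k N hN h =>
    ⟨Fin.elim0, fun i => i.elim0, hasSubset_selected_uncrowded hX pts ?_ _ h⟩
  calc k ^ 4 ≤ (2 ^ k) ^ 4 := Nat.pow_le_pow_left Nat.lt_two_pow_self.le 4
    _ = 2 ^ (4 * k) := by rw [← pow_mul, mul_comm]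
    _ ≤ 2 ^ (4 * (k * k + k + 1)) :=
      Nat.pow_le_pow_right (by omega) (Nat.mul_le_mul_left _ (by omega))
    _ = N := hN

theorem subsetKernel_of_isCol {X : Finset Plane} (hX : IsCol X) :
    SubsetKernel (Avoids X) fun k => k ^ 4 := by
  classical
  refine subsetKernel_of_candidates expresses_uncrowded
    (b := .sum 5 (.var 1) (.sum 6 (.var 1) (.sum 7 (.var 1) (.var 1)))) ?_ ?_ ?_ ?_
  · simp only [Below]; omega
  · intro χ R
    simp [eval]
    ring
  · exact fun a b h => Nat.pow_le_pow_left h 4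
  · intro n pts k h
    rcases le_total k n with hkn | hnk
    · rw [min_eq_left hkn]
      exact hasSubset_selected_uncrowded hX pts le_rfl _ h
    · rw [min_eq_right hnk]
      -- For `k ≥ n` nothing is discarded: fewer than `n * n` points precede any given one, and `n ^
      -- 4 ≥ n`.
      have huniv : selected (Uncrowded (orientationOracle pts) n n Fin.elim0) (n ^ 4) =
          (Finset.univ : Finset (Fin n)) := by
        refine Finset.filter_true_of_mem fun p _ => ⟨?_, ?_⟩
        · rintro ⟨q, _, _, hc⟩
          have h1 := hc.trans (Finset.card_filter_le _ _)
          rw [Finset.card_range] at h1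
          have h2 := p.2
          nlinarith
        · refine lt_of_le_of_lt (Finset.card_filter_le _ _) ?_
          rw [Finset.card_range]
          exact p.2.trans_le (Nat.le_self_pow (by omega) n)
      rwa [huniv]

/-! ### Patterns that are not in convex position -/

theorem expresses_true :
    Expresses (fun _ => .const 1) fun _ _ _ (_ : Fin 0 → ℕ) _ => True :=
  ⟨fun χ x R _ => by simp [eval, atMemory], fun x V _ _ => trivial⟩

theorem subsetFPT_of_not_convexPos {X : Finset Plane} (hX : ¬ IsCol X) (hX' : ¬ ConvexPos X) :
    SubsetFPT (Avoids X) := by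
  classical
  refine subsetFPT_of_candidates X 3 expresses_true fun n pts k N hN h =>
    ⟨Fin.elim0, fun i => i.elim0, ?_⟩
  rcases subset_selected_or_card_eq (n := n) (fun _ => True) N with hall | hcard
  · rwa [show selected (fun _ => True) N = (Finset.univ : Finset (Fin n)) from
      Finset.eq_univ_iff_forall.2 fun p => hall p trivial]
  set S := (selected (fun _ => True) N : Finset (Fin n)).map pts with hS
  by_cases hline : ∃ a b : Plane, a ≠ b ∧ ∃ T ⊆ S, (∀ p ∈ T, det a b p = 0) ∧ k ≤ T.card
  · obtain ⟨a, b, hab, T, hT, hT0, hkT⟩ := hline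
    obtain ⟨Y, hY, hYk⟩ := Finset.exists_subset_card_eq hkT
    exact ⟨Y, hY.trans hT, hYk, avoids_of_isCol hX ((isCol_of_line hab hT0).subset hY)⟩
  push Not at hline
  obtain ⟨Q, hQ, hQgp, hspan⟩ := exists_genPos_span S
  have hle := card_le_of_span (L := k + 1) (by omega) hQ hspan fun a _ b _ hab T hT h0 =>
    (hline a b hab T hT h0).le.trans (Nat.le_succ k)
  rw [hS, Finset.card_map, hcard, ← hN] at hle
  -- Otherwise `N ≤ (2 ^ (k * k)) ^ 2 * 2 ^ k = 2 ^ (2 * (k * k) + k)`, against `N = 2 ^ (3 * (k * k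
  -- + k + 1))`.
  have hbig : 2 ^ (k * k) < Q.card := by
    by_contra hc
    rw [not_lt] at hc
    have h1 : Q.card ^ 2 * (k + 1) ≤ (2 ^ (k * k)) ^ 2 * 2 ^ k :=
      Nat.mul_le_mul (Nat.pow_le_pow_left hc 2) Nat.lt_two_pow_self
    rw [← pow_mul, ← pow_add] at h1
    have h2 := (Nat.pow_le_pow_iff_right (by omega)).1 (hle.trans h1)
    nlinarith
  obtain ⟨C, hC, hCk, hconv⟩ := exists_convexPos hQgp hbig
  exact ⟨C, hC.trans hQ, hCk, avoids_of_convexPos hX' hconv⟩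

/-! ### Patterns in convex position -/

/-- `p` is spanned by two of the points with indices `q i`. -/
def Spanned (r : ℕ) (χ : ℕ → ℕ → ℕ → ℕ) (_ _ : ℕ) (q : Fin r → ℕ) (p : ℕ) : Prop :=
  ∃ i j, (q i = q j ∧ p = q i) ∨ (q i ≠ q j ∧ χ (q i) (q j) p = 0)

def spannedE (r x : ℕ) : Expr :=
  anyE ((List.finRange r).map fun i : Fin r => anyE ((List.finRange r).map fun j : Fin r =>
    orE (andE (eqE (.var (14 + i)) (.var (14 + j))) (eqE (.var x) (.var (14 + i))))
      (andE (notE (eqE (.var (14 + i)) (.var (14 + j))))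
        (eqE (.query (.var (14 + i)) (.var (14 + j)) (.var x)) (.const 0)))))

theorem expresses_spanned (r : ℕ) : Expresses (spannedE r) (Spanned r) := by
  refine ⟨fun χ x R _ => ?_, fun x V hV hx => ?_⟩
  · simp only [spannedE, anyE_ne_zero, List.mem_map, List.mem_finRange, true_and,
      exists_exists_eq_and, orE_ne_zero, andE_ne_zero, notE_ne_zero, eqE_ne_zero]
    rfl
  · simp only [spannedE, below_anyE, List.mem_map, List.mem_finRange, true_and,
      forall_exists_index, forall_apply_eq_imp_iff, below_orE, below_andE, below_notE, below_eqE,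
      Below, and_true]
    intro i j
    have := i.2
    have := j.2
    omega

theorem subsetFPT_of_convexPos {X : Finset Plane} (hX : ¬ IsCol X) (hX' : ConvexPos X) :
    SubsetFPT (Avoids X) := by
  classical
  set m := X.card with hm
  set r := 2 ^ (m * m) with hr
  refine subsetFPT_of_candidates X (2 * (m * m) + 1) (expresses_spanned r) fun n pts k N hN h => ?_
  obtain ⟨J, _, hJk, hJX⟩ := (hasSubset_map_iff pts).1 h
  obtain ⟨Q, hQ, hQgp, hspan⟩ := exists_genPos_span (J.map pts)
  -- More than `2 ^ (m * m)` points in general position would contain `m` in convex position, a copy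
  -- of `X` in the solution.
  have hQr : Q.card ≤ r := by
    by_contra hc
    obtain ⟨C, hC, hCm, hconv⟩ := exists_convexPos hQgp (not_le.1 hc)
    exact hJX ⟨C, hC.trans hQ, sameOrderType_of_convexPos hX' hconv (by rw [hCm])⟩
  obtain ⟨Q, hQJ, rfl⟩ := Finset.subset_map_iff.1 hQ
  rw [Finset.card_map] at hQr
  -- The tuple enumerates `Q` and is padded with `0`. Padding only adds candidates, which does no
  -- harm.
  obtain ⟨f, hf⟩ : ∃ f : Fin r → ℕ, ((∀ i, f i ≤ n) ∧ ∀ i, 0 < n → f i < n) ∧ ∀ a ∈ Q, ∃ i, f i = (a : ℕ) := by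
    refine ⟨fun i => if hi : (i : ℕ) < Q.card then ((Q.equivFin.symm ⟨i, hi⟩ : Fin n) : ℕ) else 0,
      ⟨fun i => ?_, fun i hn => ?_⟩, fun a ha => ⟨⟨Q.equivFin ⟨a, ha⟩, (Q.equivFin ⟨a, ha⟩).2.trans_le hQr⟩, ?_⟩⟩
    · simp only
      split_ifs
      · exact (Fin.is_lt _).le
      · exact Nat.zero_le n
    · simp only
      split_ifs
      · exact Fin.is_lt _
      · exact hn
    · simp
  refine ⟨f, hf.1.1, ?_⟩
  have hJs : ∀ p ∈ J, Spanned r (orientationOracle pts) n k f p := by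
    intro p hp
    obtain ⟨a, ha, b, hb, hab⟩ := hspan _ (Finset.mem_map_of_mem pts hp)
    obtain ⟨a, ha', rfl⟩ := Finset.mem_map.1 ha
    obtain ⟨b, hb', rfl⟩ := Finset.mem_map.1 hb
    obtain ⟨i, hi⟩ := hf.2 a ha'
    obtain ⟨j, hj⟩ := hf.2 b hb'
    refine ⟨i, j, ?_⟩
    rw [hi, hj]
    rcases hab with ⟨h1, h2⟩ | ⟨h1, h2⟩
    · exact .inl ⟨by rw [pts.injective h1], by rw [pts.injective h2]⟩
    · exact .inr ⟨fun hc => h1 (by rw [Fin.ext hc]), (orientationOracle_eq_zero pts a b p).2 h2⟩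
  rcases subset_selected_or_card_eq (n := n) (Spanned r (orientationOracle pts) n k f) N
    with hall | hcard
  · exact (hasSubset_map_iff pts).2 ⟨J, fun p hp => hall p (hJs p hp), hJk, hJX⟩
  set I : Finset (Fin n) := selected (Spanned r (orientationOracle pts) n k f) N with hI
  let cls : Fin r × Fin r → Finset (Fin n) := fun ij => I.filter fun p =>
    (f ij.1 = f ij.2 ∧ (p : ℕ) = f ij.1) ∨
      (f ij.1 ≠ f ij.2 ∧ orientationOracle pts (f ij.1) (f ij.2) p = 0)
  obtain ⟨ij, hij⟩ : ∃ ij, k ≤ (cls ij).card := by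
    by_contra hc
    push Not at hc
    have hsub : I ⊆ Finset.univ.biUnion cls := fun p hp => by
      obtain ⟨i, j, h⟩ := (Finset.mem_filter.1 hp).2.1
      exact Finset.mem_biUnion.2 ⟨(i, j), Finset.mem_univ _, Finset.mem_filter.2 ⟨hp, h⟩⟩
    have hle := (Finset.card_le_card hsub).trans
      (Finset.card_biUnion_le_card_mul _ _ k fun ij _ => (hc ij).le)
    rw [hcard, Finset.card_univ, Fintype.card_prod, Fintype.card_fin] at hle
    have h1 : r * r * k < r * r * 2 ^ k :=
      Nat.mul_lt_mul_of_pos_left Nat.lt_two_pow_self (by positivity)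
    have h2 : r * r * 2 ^ k ≤ N := by
      rw [← hN, hr, ← pow_add, ← pow_add]
      exact Nat.pow_le_pow_right (by omega) (by nlinarith)
    omega
  obtain ⟨Y, hY, hYk⟩ := Finset.exists_subset_card_eq hij
  refine (hasSubset_map_iff pts).2 ⟨Y, hY.trans (Finset.filter_subset _ _), hYk,
    avoids_of_isCol hX ?_⟩
  -- For `n = 0` the value `0` in the tuple is not the index of a point, so this case is separate.
  rcases Nat.eq_zero_or_pos n with rfl | hn
  · rw [Finset.eq_empty_of_isEmpty Y, Finset.map_empty]
    exact isCol_of_card_le_two (by simp)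
  refine isCol_of_inSpan (a := pts ⟨f ij.1, hf.1.2 _ hn⟩) (b := pts ⟨f ij.2, hf.1.2 _ hn⟩) ?_
  intro x hx
  obtain ⟨p, hp, rfl⟩ := Finset.mem_map.1 hx
  rcases (Finset.mem_filter.1 (hY hp)).2 with ⟨h1, h2⟩ | ⟨h1, h2⟩
  · exact .inl ⟨congrArg pts (Fin.ext h1), congrArg pts (Fin.ext h2)⟩
  · exact .inr ⟨fun hc => h1 (congrArg Fin.val (pts.injective hc)),
      (orientationOracle_eq_zero pts ⟨f ij.1, hf.1.2 _ hn⟩ ⟨f ij.2, hf.1.2 _ hn⟩ p).1 h2⟩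

end PointPatterns

/-! ### The case distinction on the pattern -/

theorem mainTheorem3 (X : Finset PointPatterns.Plane) :
    PointPatterns.SubsetFPT (PointPatterns.Avoids X) ∧
      (Collinear ℝ (X : Set PointPatterns.Plane) →
        ∃ C : ℕ, PointPatterns.SubsetKernel (PointPatterns.Avoids X) (fun k => C * k ^ 4)) := by
  refine ⟨?_, fun hX => ⟨1, ?_⟩⟩
  · by_cases hX : PointPatterns.IsCol X
    · exact PointPatterns.subsetFPT_of_isCol hX
    · by_cases hX' : PointPatterns.ConvexPos X
      · exact PointPatterns.subsetFPT_of_convexPos hX hX'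
      · exact PointPatterns.subsetFPT_of_not_convexPos hX hX'
  · simpa only [one_mul] using
      PointPatterns.subsetKernel_of_isCol (PointPatterns.isCol_of_collinear hX)
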